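/- Let $\Gamma(u)(x)=\sum_{n=1}^N\alpha_n\int_{\mathbb R_+^n}A_n(da)\prod_{k=1}^n u(a_kx)$, $x\ge 0$, where $\alpha_n\ge0$, $\sum_n\alpha_n=1$, and $A_n$ is a compactly supported probability measure on $\mathbb R_+^n=[0,\infty)^n$. Let $K=\sum_n\alpha_n\sum_{k=1}^nA_n^{(k)}$, with $A_n^{(k)}$ the $k$-th one-dimensional marginal of $A_n$, and for $s>0$ put $\lambda(s)=\int_0^\infty a^s\,K(da)$ and $\mu(s)=(\lambda(s)-1)/s$ (the spectral function). Let $p_0\in[0,\infty]$ be the right end point of the interval $(0,p_0)$ on which $\mu$ is strictly decreasing (if $0<p_0<\infty$, it is the point at which $\mu$ attains its minimum). Let $0<p\le1$ with $p<p_0$, and let $d\ge1$. Self-similar profile: a continuous $\psi_p:[0,\infty)\to\mathbb R$ with $|\psi_p|\le1$ which solves $$\psi_p(x)=\int_0^1\Gamma(\psi_p)(x\tau^{\mu(p)})\,d\tau\qquad(x\ge0)$$ (the integrated form of $\mu(p)\,x\,\psi_p'+\psi_p=\Gamma(\psi_p)$) and satisfies $\psi_p(x)=1-x^p+O(x^{p+\varepsilon})$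 for some $\varepsilon>0$. Let $R_p$, $\Phi_p$ be probability measures on $[0,\infty)$ and $F_p$ a probability measure on $\mathbb R^d$ with $$\psi_p(x)=\int_0^\infty e^{-\tau x^p}R_p(d\tau)=\int_0^\infty e^{-xv}\,\Phi_p(dv)\quad(x\ge0),\qquad \psi_p(|k|^2)=\int_{\mathbb R^d}e^{-ik\cdot v}F_p(dv)\quad(k\in\mathbb R^d).$$ For $s>0$ let $m_{2s}(F_p)=\int_{\mathbb R^d}|v|^{2s}F_p(dv)$ and $m_s(\Phi_p)=\int_0^\infty v^s\,\Phi_p(dv)$, with values in $[0,\infty]$. **Proposition.** Such $\psi_p,R_p,F_p,\Phi_p$ exist, and for all such $\psi_p,R_p,F_p,\Phi_p$ the following holds. [i] If $0<p<1$, then for every $s>0$: $m_{2s}(F_p)<\infty$ if and only if $s<p$, and $m_s(\Phi_p)<\infty$ if and only if $s<p$. [ii] If $p=1$ (so that $p_0>1$), then the following holds for $m_s=m_{2s}(F_1)$ and also for $m_s=m_s(\Phi_1)$: (a) if $s=1$ is the only solution $s>0$ of $\mu(s)=\mu(1)$, then $m_s<\infty$ for all $s>0$; (b) if $\mu(s_*)=\mu(1)$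 for some $s_*>1$, then $m_s<\infty$ for $0<s<s_*$ and $m_s=\infty$ for $s>s_*$; (c) in the situation of (b), $m_{s_*}<\infty$ only if $I_n(s_*)=0$ for every $n\in\{2,\dots,N\}$ with $\alpha_n>0$, where $$I_n(s)=\int_{\mathbb R_+^n}A_n(da)\int_{\mathbb R_+^n}R_1(d\tau_1)\cdots R_1(d\tau_n)\Big[\Big(\sum_{k=1}^na_k\tau_k\Big)^s-\sum_{k=1}^n(a_k\tau_k)^s\Big].$$ -/

import Mathlib

open MeasureTheory
open scoped NNReal ENNReal

noncomputable section

/-- Data of a multi-linear Maxwell model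
`u_t + u = Γ(u)`, `Γ = ∑_{n=1}^N α_n Γ^{(n)}`.
The index `i : Fin N` stands for the interaction of `n = i + 1` particles: `α i` is `α_n` and
`A i` is the probability measure `A_n(a_1, …, a_n) da_1 … da_n` on `ℝ₊ⁿ`, with bounded support.
The kernels are not required to be symmetric. -/
structure MaxwellModel (N : ℕ) where
  α : Fin N → ℝ
  α_nonneg : ∀ i, 0 ≤ α i
  sum_α : ∑ i, α i = 1
  A : (i : Fin N) → Measure (Fin (i.val + 1) → ℝ≥0)
  isProbabilityMeasure_A : ∀ i, IsProbabilityMeasure (A i)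
  bounded_support : ∃ r : ℝ, 0 < r ∧ ∀ i, ∀ᵐ a ∂(A i), ∑ k, ((a k : ℝ≥0) : ℝ) ^ 2 ≤ r ^ 2

namespace MaxwellModel

variable {N : ℕ}

/-- The operator `Γ(u)(x) = ∑ₙ αₙ ∫ Aₙ(da) ∏ₖ u(aₖ x)`. -/
def Gam (M : MaxwellModel N) (u : ℝ≥0 → ℝ) (x : ℝ≥0) : ℝ :=
  ∑ i, M.α i * ∫ a, ∏ k, u (a k * x) ∂(M.A i)

/-- The kernel `K(a) da` of the linearization `Lu(x) = ∫ K(da) u(ax)` of `Γ` at `u = 1`: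
the sum over `n` of `αₙ` times the sum of the `n` one-dimensional marginals of `Aₙ`.
For a symmetric `Aₙ` the `n` marginals coincide, which gives `K = ∑ₙ n αₙ Kₙ` with `Kₙ` the first
marginal. -/
def K (M : MaxwellModel N) : Measure ℝ≥0 :=
  ∑ i, ENNReal.ofReal (M.α i) • ∑ k, (M.A i).map (fun a => a k)

/-- `λ(p) = ∫ K(da) a^p`. -/
def lam (M : MaxwellModel N) (p : ℝ) : ℝ := ∫ a, (a : ℝ) ^ p ∂M.K

/-- The spectral function `μ(p) = (λ(p) - 1) / p`, for `p > 0`. -/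
def mu (M : MaxwellModel N) (p : ℝ) : ℝ := (M.lam p - 1) / p

/-- The critical exponent `p₀ ∈ [0, ∞]`: the right end point of the interval `(0, p₀)` on which the
spectral function is strictly decreasing. Since `p μ(p)` is convex, `μ` increases after `p₀`, so
that `μ` attains its minimum at `p₀` if `0 < p₀ < ∞`, and is decreasing throughout if `p₀ = ∞`. -/
def critExp (M : MaxwellModel N) : ℝ≥0∞ :=
  sSup (ENNReal.ofReal '' {r : ℝ | 0 < r ∧ StrictAntiOn M.mu (Set.Ioc 0 r)})

/-- `ψ` is the self-similar profile `ψ_p`: a continuous function on `ℝ₊` with `‖ψ‖ ≤ 1` such that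
`ψ(x) = ∫₀¹ Γ(ψ)(x τ^μ) dτ` with `μ = μ(p)` (the integrated form of
`μ x ψ'(x) + ψ(x) = Γ(ψ)(x)`, i.e. `ψ(x e^{μ t})` solves `u_t + u = Γ(u)`), normalized by
`ψ(x) = 1 - x^p + O(x^{p+ε})` for some `ε > 0`. -/
structure IsProfile (M : MaxwellModel N) (p : ℝ) (ψ : ℝ≥0 → ℝ) : Prop where
  continuous : Continuous ψ
  abs_le_one : ∀ x, |ψ x| ≤ 1
  equation : ∀ x : ℝ≥0,
    ψ x = ∫ τ in Set.Ioc (0 : ℝ) 1, M.Gam ψ (x * Real.toNNReal (τ ^ M.mu p))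
  asymptotics : ∃ ε : ℝ, 0 < ε ∧ ∃ C : ℝ, ∀ x : ℝ≥0,
    |ψ x - (1 - (x : ℝ) ^ p)| ≤ C * (x : ℝ) ^ (p + ε)

/-- `I_n(s) = ∫ Aₙ(da) ∫ R(dτ₁) ⋯ R(dτₙ) g_n^{(s)}(a₁τ₁, …, aₙτₙ)` with
`g_n^{(s)}(y) = (∑ yₖ)^s - ∑ yₖ^s`, which is nonnegative for `s ≥ 1`; here `n = i + 1`. -/
def I (M : MaxwellModel N) (R : Measure ℝ≥0) (i : Fin N) (s : ℝ) : ℝ≥0∞ :=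
  ∫⁻ a, ∫⁻ τ, ENNReal.ofReal
      ((∑ k, ((a k * τ k : ℝ≥0) : ℝ)) ^ s - ∑ k, ((a k * τ k : ℝ≥0) : ℝ) ^ s)
    ∂(Measure.pi (fun _ : Fin (i.val + 1) => R)) ∂(M.A i)

/-- The moment alternative for a family of moments `m s`, `s > 0`, in terms of the roots of
`μ(s) = μ(1)`. -/
def MomentAlternative (M : MaxwellModel N) (R : Measure ℝ≥0) (m : ℝ → ℝ≥0∞) : Prop :=
  ((∀ s : ℝ, 0 < s → M.mu s = M.mu 1 → s = 1) → ∀ s : ℝ, 0 < s → m s < ∞) ∧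
  ∀ t : ℝ, 1 < t → M.mu t = M.mu 1 →
    (∀ s : ℝ, 0 < s → s < t → m s < ∞) ∧
    (∀ s : ℝ, t < s → m s = ∞) ∧
    (m t < ∞ → ∀ i : Fin N, 2 ≤ i.val + 1 → 0 < M.α i → M.I R i t = 0)

end MaxwellModel

/-- `R = R_p`: the probability measure on `ℝ₊` with `ψ(x) = ∫ R(dτ) e^{-τ x^p}`. -/
def IsMixingMeasure (p : ℝ) (ψ : ℝ≥0 → ℝ) (R : Measure ℝ≥0) : Prop :=
  IsProbabilityMeasure R ∧ ∀ x : ℝ≥0, ∫ τ, Real.exp (-((τ : ℝ) * (x : ℝ) ^ p)) ∂(R) = ψ x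

/-- `F = F_p`: the (generalized) distribution function on `ℝ^d`, i.e. probability measure, whose
Fourier transform at `k` is `ψ(|k|²)`. As `ψ(|k|²)` is even in `k`, the sign in the exponent
is immaterial. -/
def IsFourierDistribution {d : ℕ} (ψ : ℝ≥0 → ℝ) (F : Measure (EuclideanSpace ℝ (Fin d))) : Prop :=
  IsProbabilityMeasure F ∧
    ∀ k : EuclideanSpace ℝ (Fin d), charFun F k = ((ψ (‖k‖₊ ^ 2) : ℝ) : ℂ)

/-- `Φ = Φ_p`: the (generalized) distribution function on `ℝ₊`, i.e. probability measure, whose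
Laplace transform is `ψ`. -/
def IsLaplaceDistribution (ψ : ℝ≥0 → ℝ) (Φ : Measure ℝ≥0) : Prop :=
  IsProbabilityMeasure Φ ∧ ∀ x : ℝ≥0, ∫ v, Real.exp (-((x : ℝ) * (v : ℝ))) ∂Φ = ψ x

/-- `m_{2s}(F) = ∫ F(dv) |v|^{2s}`. -/
def fourierMoment {d : ℕ} (F : Measure (EuclideanSpace ℝ (Fin d))) (s : ℝ) : ℝ≥0∞ :=
  ∫⁻ v, ENNReal.ofReal (‖v‖ ^ (2 * s)) ∂F

/-- `m_s(Φ) = ∫ Φ(dv) v^s`. -/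
def laplaceMoment (Φ : Measure ℝ≥0) (s : ℝ) : ℝ≥0∞ :=
  ∫⁻ v, ENNReal.ofReal ((v : ℝ) ^ s) ∂Φ

end

/-! With c = μ(p), the profile equation says that ψ is fixed by the averaged operator `avgT` c. On
functions of the form x ↦ E exp(-x^q X) this operator acts through the law of X: X is replaced by
U^{cq} ∑ aₖ^q Xₖ, the smoothing transform (`laplace_smooth`). Everything combines the analytic and
the probabilistic side of this correspondence.

Analytically, telescoping products gives `abs_avgT_sub_le`: a difference bounded by C x^s is
multiplied by λ(s)/(1 + cs), which is less than one precisely when μ(s) < c. Since p < p₀, this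
holds for s slightly above p. As e^{-x^p} is moved only by O(x^s), its iterates converge; the limit
is a profile, and every profile is this limit, hence unique. Probabilistically, the iterates are
transforms of probability measures that are tight by the same estimates, so the limit is a transform
too. Taking q = p and starting from a unit mass gives R; taking q = 1 and starting from a Pareto law
with expansion 1 - x^p + O(x) gives Φ. The Gaussian mixture √(2V) G with V of law Φ then gives F,
and its moments of order 2s are finite exactly when those of Φ of order s are.

For p < 1, fractional moments are integrals of (1 - ψ(x)) x^{-s-1}, so the behaviour 1 - ψ ~ x^p at
the origin decides their finiteness (`laplaceMoment_lt_top_iff_of_asymptotics`).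

For p = 1, R = Φ is a fixed point of the smoothing transform. If μ < μ(1) on (1, s], the moments of
order s stay bounded along the iteration: in (∑ yₖ)^s the pure powers contribute λ(s) m_s, while
mixed terms involve only m_1 and m_{s-1} (`exists_sumMoment_le`), which permits induction on s; the
bound survives the weak limit. Conversely, a finite m_s satisfies (1 + μ(1)s) m_s = ∑ αₙ Iₙ(s) +
λ(s) m_s (`moment_identity_of_fixed`). By convexity of λ, μ(s) > μ(1) beyond the second root, which
is then contradictory; at the root itself the moment terms cancel and every Iₙ with αₙ > 0 vanishes.
-/

open Filter Topology

/-! ### Laplace transforms on the half-line: uniqueness, tightness and continuity. -/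

/-- The Laplace transform of a measure on `ℝ≥0`. -/
noncomputable def laplace (R : Measure ℝ≥0) (y : ℝ) : ℝ := ∫ τ, Real.exp (-((τ : ℝ) * y)) ∂(R)

lemma integrable_exp_neg_mul (R : Measure ℝ≥0) [IsFiniteMeasure R] {y : ℝ} (hy : 0 ≤ y) :
    Integrable (fun τ : ℝ≥0 => Real.exp (-((τ : ℝ) * y))) R := by
  refine Integrable.of_bound (C := 1) (by fun_prop) (ae_of_all _ fun τ => ?_)
  rw [Real.norm_eq_abs, abs_of_pos (Real.exp_pos _), Real.exp_le_one_iff]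
  have := τ.coe_nonneg
  simp only [Left.neg_nonpos_iff]; positivity

lemma laplace_nonneg (R : Measure ℝ≥0) (y : ℝ) : 0 ≤ laplace R y :=
  integral_nonneg fun _ => (Real.exp_pos _).le

lemma laplace_le_one (R : Measure ℝ≥0) [IsProbabilityMeasure R] {y : ℝ} (hy : 0 ≤ y) :
    laplace R y ≤ 1 := by
  have : laplace R y ≤ ∫ _, (1 : ℝ) ∂(R) := by
    refine integral_mono (integrable_exp_neg_mul R hy) (by simp) fun τ => ?_
    rw [Real.exp_le_one_iff]
    have := τ.coe_nonneg
    rw [Left.neg_nonpos_iff]; positivity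
  simpa using this

lemma abs_laplace_le_one (R : Measure ℝ≥0) [IsProbabilityMeasure R] {y : ℝ} (hy : 0 ≤ y) :
    |laplace R y| ≤ 1 := by
  rw [abs_of_nonneg (laplace_nonneg R y)]; exact laplace_le_one R hy

lemma continuous_laplace_comp (R : Measure ℝ≥0) [IsFiniteMeasure R] {X : Type*}
    [TopologicalSpace X] [FirstCountableTopology X] {g : X → ℝ} (hg : Continuous g)
    (h0 : ∀ x, 0 ≤ g x) : Continuous fun x => laplace R (g x) := by
  refine continuous_of_dominated (bound := fun _ => 1) (fun x => by fun_prop) ?_ (by simp) ?_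
  · refine fun x => ae_of_all _ fun τ => ?_
    rw [Real.norm_eq_abs, abs_of_pos (Real.exp_pos _), Real.exp_le_one_iff]
    have := τ.coe_nonneg
    have := h0 x
    rw [Left.neg_nonpos_iff]; positivity
  · exact ae_of_all _ fun τ => by fun_prop

/-- The function `v ↦ e^{-v y}` as a bounded continuous function on `ℝ≥0`. -/
noncomputable def expBCF (y : ℝ) (hy : 0 ≤ y) : BoundedContinuousFunction ℝ≥0 ℝ :=
  BoundedContinuousFunction.ofNormedAddCommGroup (fun τ : ℝ≥0 => Real.exp (-((τ : ℝ) * y)))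
    (by fun_prop) 1 (fun τ => by
      rw [Real.norm_eq_abs, abs_of_pos (Real.exp_pos _), Real.exp_le_one_iff]
      have := τ.coe_nonneg
      rw [Left.neg_nonpos_iff]; positivity)

@[simp] lemma expBCF_apply (y : ℝ) (hy : 0 ≤ y) (τ : ℝ≥0) :
    expBCF y hy τ = Real.exp (-((τ : ℝ) * y)) := rfl

/-- The algebra of polynomials in `e^{-v}`. -/
noncomputable def expPoly : StarSubalgebra ℝ (BoundedContinuousFunction ℝ≥0 ℝ) where
  carrier := {g | ∃ P : Polynomial ℝ, ∀ v, g v = P.eval (Real.exp (-(v : ℝ)))}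
  mul_mem' := by
    rintro f g ⟨P, hP⟩ ⟨Q, hQ⟩
    exact ⟨P * Q, fun v => by simp [hP, hQ]⟩
  add_mem' := by
    rintro f g ⟨P, hP⟩ ⟨Q, hQ⟩
    exact ⟨P + Q, fun v => by simp [hP, hQ]⟩
  algebraMap_mem' := fun c => ⟨Polynomial.C c, fun v => by simp⟩
  star_mem' := by
    rintro f ⟨P, hP⟩
    exact ⟨P, fun v => by simp [hP]⟩

lemma expPoly_separatesPoints :
    (expPoly.map (BoundedContinuousFunction.toContinuousMapStarₐ ℝ)).SeparatesPoints := by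
  intro x y hxy
  refine ⟨expBCF 1 zero_le_one, ⟨(BoundedContinuousFunction.toContinuousMapStarₐ ℝ)
    (expBCF 1 zero_le_one), ⟨expBCF 1 zero_le_one, ⟨Polynomial.X, fun v => by simp⟩, rfl⟩, rfl⟩, ?_⟩
  simpa using hxy

lemma integral_expPoly (R : Measure ℝ≥0) [IsFiniteMeasure R] (P : Polynomial ℝ) :
    ∫ v, P.eval (Real.exp (-((v : ℝ≥0) : ℝ))) ∂(R) = P.sum fun n a => a * laplace R n := by
  simp_rw [Polynomial.eval_eq_sum, Polynomial.sum]
  have key : ∀ n : ℕ, ∀ v : ℝ≥0, Real.exp (-(v : ℝ)) ^ n = Real.exp (-((v : ℝ) * n)) := by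
    intro n v
    rw [← Real.exp_nat_mul]; congr 1; ring
  simp_rw [key]
  rw [integral_finsetSum]
  · exact Finset.sum_congr rfl fun n _ => by rw [integral_const_mul]; rfl
  · exact fun n _ => (integrable_exp_neg_mul R n.cast_nonneg).const_mul _

/-- Stone–Weierstrass: polynomials in e^{-v} separate points, and their integrals are combinations
of the transform at natural numbers. -/
theorem ext_of_laplace {R Q : Measure ℝ≥0} [IsFiniteMeasure R] [IsFiniteMeasure Q]
    (h : ∀ y : ℝ, 0 ≤ y → laplace R y = laplace Q y) : R = Q := by
  refine ext_of_forall_mem_subalgebra_integral_eq_of_pseudoEMetric_complete_countable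
    expPoly_separatesPoints ?_
  rintro g ⟨P, hP⟩
  simp_rw [hP, integral_expPoly]
  exact Finset.sum_congr rfl fun n _ => by dsimp only; rw [h _ n.cast_nonneg]

/-- Markov's inequality for 1 - e^{-τy}, which is at least 1 - e^{-1} once τ > 1/y. -/
lemma measure_Icc_compl_le (R : Measure ℝ≥0) [IsProbabilityMeasure R] {y : ℝ} (hy : 0 < y) :
    R (Set.Icc 0 (Real.toNNReal y⁻¹))ᶜ ≤
      ENNReal.ofReal ((1 - laplace R y) / (1 - Real.exp (-1))) := by
  have he : 0 < 1 - Real.exp (-1) := by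
    have : Real.exp (-1) < 1 := by rw [Real.exp_lt_one_iff]; norm_num
    linarith
  have hint : Integrable (fun τ : ℝ≥0 => 1 - Real.exp (-((τ : ℝ) * y))) R :=
    (integrable_const _).sub (integrable_exp_neg_mul R hy.le)
  have h0 : ∀ τ : ℝ≥0, 0 ≤ 1 - Real.exp (-((τ : ℝ) * y)) := fun τ => by
    have := τ.coe_nonneg
    have : Real.exp (-((τ : ℝ) * y)) ≤ 1 := by
      rw [Real.exp_le_one_iff, Left.neg_nonpos_iff]; positivity
    linarith
  have h1 : ∫ τ, (1 - Real.exp (-((τ : ℝ≥0) * y : ℝ))) ∂(R) = 1 - laplace R y := by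
    rw [integral_sub (integrable_const _) (integrable_exp_neg_mul R hy.le)]
    simp [laplace]
  have hm := mul_meas_ge_le_integral_of_nonneg (ae_of_all R h0) hint (1 - Real.exp (-1))
  rw [h1] at hm
  have hsub : (Set.Icc 0 (Real.toNNReal y⁻¹))ᶜ ⊆
      {τ : ℝ≥0 | 1 - Real.exp (-1) ≤ 1 - Real.exp (-((τ : ℝ) * y))} := by
    intro τ hτ
    simp only [Set.mem_compl_iff, Set.mem_Icc, zero_le, true_and, not_le] at hτ
    rw [Real.toNNReal_lt_iff_lt_coe (by positivity)] at hτ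
    simp only [Set.mem_ofPred_eq, sub_le_sub_iff_left, Real.exp_le_exp, neg_le_neg_iff]
    have := mul_le_mul_of_nonneg_right hτ.le hy.le
    rwa [inv_mul_cancel₀ hy.ne'] at this
  calc R (Set.Icc 0 (Real.toNNReal y⁻¹))ᶜ ≤ R {τ : ℝ≥0 | 1 - Real.exp (-1) ≤ 1 - Real.exp (-((τ : ℝ) * y))} :=
        measure_mono hsub
    _ = ENNReal.ofReal (R.real {τ : ℝ≥0 | 1 - Real.exp (-1) ≤ 1 - Real.exp (-((τ : ℝ) * y))}) :=
        (ofReal_measureReal (measure_ne_top _ _)).symm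
    _ ≤ _ := by
      refine ENNReal.ofReal_le_ofReal ?_
      rw [le_div_iff₀ he, mul_comm]
      exact hm

theorem isTightMeasureSet_of_laplace {R : ℕ → ProbabilityMeasure ℝ≥0} {g : ℝ → ℝ}
    (hg : ∀ n y, 0 < y → 1 - laplace (R n) y ≤ g y) (hg0 : Tendsto g (𝓝[>] 0) (𝓝 0)) :
    IsTightMeasureSet {((μ : ProbabilityMeasure ℝ≥0) : Measure ℝ≥0) | μ ∈ Set.range R} := by
  rw [isTightMeasureSet_iff_exists_isCompact_measure_compl_le]
  intro ε hε
  have he : 0 < 1 - Real.exp (-1) := by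
    have : Real.exp (-1) < 1 := by rw [Real.exp_lt_one_iff]; norm_num
    linarith
  have h1 : Tendsto (fun y => ENNReal.ofReal (g y / (1 - Real.exp (-1)))) (𝓝[>] 0) (𝓝 0) := by
    have := ENNReal.tendsto_ofReal (hg0.div_const (1 - Real.exp (-1)))
    simpa using this
  obtain ⟨y, hy1, hy2⟩ := ((h1.eventually (gt_mem_nhds hε)).and self_mem_nhdsWithin).exists
  refine ⟨Set.Icc 0 (Real.toNNReal y⁻¹), isCompact_Icc, ?_⟩
  rintro _ ⟨_, ⟨n, rfl⟩, rfl⟩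
  refine (measure_Icc_compl_le (R n : Measure ℝ≥0) hy2).trans (le_trans ?_ hy1.le)
  refine ENNReal.ofReal_le_ofReal (div_le_div_of_nonneg_right (hg n y hy2) he.le)

/-- Continuity theorem for Laplace transforms, with Fatou's inequality for the limit. -/
theorem exists_laplace_limit {R : ℕ → Measure ℝ≥0} [hR : ∀ n, IsProbabilityMeasure (R n)]
    {g f : ℝ → ℝ}
    (hg : ∀ n y, 0 < y → 1 - laplace (R n) y ≤ g y) (hg0 : Tendsto g (𝓝[>] 0) (𝓝 0))
    (hf : ∀ y, 0 ≤ y → Tendsto (fun n => laplace (R n) y) atTop (𝓝 (f y))) :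
    ∃ Q : Measure ℝ≥0, IsProbabilityMeasure Q ∧ (∀ y, 0 ≤ y → laplace Q y = f y) ∧
      ∀ (h : ℝ≥0 → ℝ) (c : ℝ≥0∞), Continuous h → 0 ≤ h →
        (∀ n, ∫⁻ v, ENNReal.ofReal (h v) ∂(R n) ≤ c) → ∫⁻ v, ENNReal.ofReal (h v) ∂(Q) ≤ c := by
  let S : ℕ → ProbabilityMeasure ℝ≥0 := fun n => ⟨R n, hR n⟩
  have hc : IsCompact (closure (Set.range S)) :=
    isCompact_closure_of_isTightMeasureSet (isTightMeasureSet_of_laplace (R := S) hg hg0)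
  obtain ⟨ν, -, φ, hφ, hν⟩ := hc.tendsto_subseq fun n => subset_closure ⟨n, rfl⟩
  refine ⟨ν, inferInstance, fun y hy => ?_, fun h c hh h0 hle => ?_⟩
  -- A subsequence suffices, because convergence of the transforms to f is given along the whole
  -- sequence.
  · have h1 := (ProbabilityMeasure.tendsto_iff_forall_integral_tendsto.1 hν) (expBCF y hy)
    exact tendsto_nhds_unique h1 ((hf y hy).comp hφ.tendsto_atTop)
  · refine (lintegral_le_liminf_lintegral_of_forall_isOpen_measure_le_liminf_measure hh h0
      (μs := fun n => (S (φ n) : Measure ℝ≥0)) fun G hG =>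
        ProbabilityMeasure.le_liminf_measure_open_of_tendsto hν hG).trans ?_
    exact liminf_le_of_le (by isBoundedDefault) fun b hb =>
      let ⟨n, hn⟩ := hb.exists
      hn.trans (hle (φ n))

/-! ### The smoothing transform and the averaged operator. -/

namespace MaxwellModel

variable {N : ℕ}

attribute [instance] isProbabilityMeasure_A

/-- The smoothing transform of `R`: the law of `U^{cq} ∑ₖ aₖ^q Xₖ`, where `U` is uniform on
`(0, 1]`, `n` is distributed according to `α`, `a` according to `Aₙ`, and the `Xₖ` are
independent with law `R`. -/
noncomputable def smooth (M : MaxwellModel N) (c q : ℝ) (R : Measure ℝ≥0) : Measure ℝ≥0 :=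
  ∑ i, ENNReal.ofReal (M.α i) •
    ((volume.restrict (Set.Ioc (0 : ℝ) 1)).prod
      ((M.A i).prod (Measure.pi fun _ : Fin (i.val + 1) => R))).map
      (fun z => Real.toNNReal (z.1 ^ (c * q)) * ∑ k, (z.2.1 k) ^ q * z.2.2 k)

/-- The averaged operator `u ↦ ∫₀¹ Γ(u)(x τ^c) dτ`. -/
noncomputable def avgT (M : MaxwellModel N) (c : ℝ) (u : ℝ≥0 → ℝ) (x : ℝ≥0) : ℝ :=
  ∫ τ in Set.Ioc (0 : ℝ) 1, M.Gam u (x * Real.toNNReal (τ ^ c))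

instance : IsProbabilityMeasure (volume.restrict (Set.Ioc (0 : ℝ) 1)) :=
  ⟨by simp⟩

lemma measurable_smooth_map {n : ℕ} (c q : ℝ) :
    Measurable (fun z : ℝ × (Fin n → ℝ≥0) × (Fin n → ℝ≥0) =>
      Real.toNNReal (z.1 ^ (c * q)) * ∑ k, (z.2.1 k) ^ q * z.2.2 k) := by
  fun_prop

lemma sum_ofReal_α (M : MaxwellModel N) : ∑ i, ENNReal.ofReal (M.α i) = 1 := by
  rw [← ENNReal.ofReal_sum_of_nonneg fun i _ => M.α_nonneg i, M.sum_α, ENNReal.ofReal_one]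

instance (M : MaxwellModel N) (c q : ℝ) (R : Measure ℝ≥0) [IsProbabilityMeasure R] :
    IsProbabilityMeasure (M.smooth c q R) := by
  refine ⟨?_⟩
  simp only [smooth, Measure.coe_finsetSum, Finset.sum_apply, Measure.smul_apply, smul_eq_mul]
  rw [← M.sum_ofReal_α]
  refine Finset.sum_congr rfl fun i _ => ?_
  have := Measure.isProbabilityMeasure_map
    (μ := (volume.restrict (Set.Ioc (0 : ℝ) 1)).prod
      ((M.A i).prod (Measure.pi fun _ : Fin (i.val + 1) => R)))
      (measurable_smooth_map (n := i.val + 1) c q).aemeasurable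
  rw [measure_univ, mul_one]

lemma lintegral_smooth (M : MaxwellModel N) (c q : ℝ) (R : Measure ℝ≥0) [IsProbabilityMeasure R]
    {h : ℝ≥0 → ℝ≥0∞} (hh : Measurable h) :
    ∫⁻ v, h v ∂(M.smooth c q R) = ∑ i, ENNReal.ofReal (M.α i) *
      ∫⁻ τ in Set.Ioc (0 : ℝ) 1, ∫⁻ a, ∫⁻ t,
        h (Real.toNNReal (τ ^ (c * q)) * ∑ k, (a k) ^ q * t k)
          ∂(Measure.pi fun _ : Fin (i.val + 1) => R) ∂(M.A i) := by
  rw [smooth, lintegral_finsetSum_measure]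
  refine Finset.sum_congr rfl fun i _ => ?_
  rw [lintegral_smul_measure, lintegral_map hh (measurable_smooth_map c q), smul_eq_mul]
  congr 1
  have hm : Measurable (fun z : ℝ × (Fin (i.val + 1) → ℝ≥0) × (Fin (i.val + 1) → ℝ≥0) =>
    h (Real.toNNReal (z.1 ^ (c * q)) * ∑ k, (z.2.1 k) ^ q * z.2.2 k)) :=
    hh.comp (measurable_smooth_map c q)
  rw [lintegral_prod _ hm.aemeasurable]
  refine lintegral_congr fun τ => ?_
  exact lintegral_prod _ (hm.comp (measurable_prodMk_left (x := τ))).aemeasurable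

lemma measurable_prod_comp {n : ℕ} {u : ℝ≥0 → ℝ} (hu : Measurable u) :
    Measurable (fun z : ℝ≥0 × (Fin n → ℝ≥0) => ∏ k, u (z.2 k * z.1)) := by
  fun_prop

lemma abs_prod_le_one {n : ℕ} {u : ℝ≥0 → ℝ} (hu : ∀ x, |u x| ≤ 1) (a : Fin n → ℝ≥0) :
    |∏ k, u (a k)| ≤ 1 := by
  rw [Finset.abs_prod]
  exact Finset.prod_le_one (fun _ _ => abs_nonneg _) fun _ _ => hu _

lemma integrable_prod_comp (M : MaxwellModel N) {u : ℝ≥0 → ℝ} (hu : Measurable u)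
    (h1 : ∀ x, |u x| ≤ 1) (i : Fin N) (y : ℝ≥0) :
    Integrable (fun a => ∏ k, u (a k * y)) (M.A i) :=
  Integrable.of_bound (C := 1) ((measurable_prod_comp hu).comp
    (measurable_prodMk_left (x := y))).aestronglyMeasurable
    (ae_of_all _ fun a => abs_prod_le_one h1 fun k => a k * y)

lemma measurable_integral_prod_comp (M : MaxwellModel N) {u : ℝ≥0 → ℝ} (hu : Measurable u)
    (i : Fin N) : Measurable fun y : ℝ≥0 => ∫ a, ∏ k, u (a k * y) ∂(M.A i) :=
  ((measurable_prod_comp hu).stronglyMeasurable.integral_prod_right').measurable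

lemma abs_integral_prod_comp_le (M : MaxwellModel N) {u : ℝ≥0 → ℝ}
    (h1 : ∀ x, |u x| ≤ 1) (i : Fin N) (y : ℝ≥0) :
    |∫ a, ∏ k, u (a k * y) ∂(M.A i)| ≤ 1 := by
  have := norm_integral_le_of_norm_le_const (μ := M.A i) (C := 1)
    (f := fun a => ∏ k, u (a k * y)) (ae_of_all _ fun a => abs_prod_le_one h1 fun k => a k * y)
  simpa using this

lemma measurable_Gam (M : MaxwellModel N) {u : ℝ≥0 → ℝ} (hu : Measurable u) :
    Measurable (M.Gam u) := by
  have := M.measurable_integral_prod_comp hu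
  unfold Gam
  fun_prop

lemma abs_Gam_le_one (M : MaxwellModel N) {u : ℝ≥0 → ℝ} (h1 : ∀ x, |u x| ≤ 1) (y : ℝ≥0) :
    |M.Gam u y| ≤ 1 := by
  unfold Gam
  refine (Finset.abs_sum_le_sum_abs _ _).trans ?_
  rw [← M.sum_α]
  refine Finset.sum_le_sum fun i _ => ?_
  rw [abs_mul, abs_of_nonneg (M.α_nonneg i)]
  exact mul_le_of_le_one_right (M.α_nonneg i) (M.abs_integral_prod_comp_le h1 i y)

lemma integrable_Gam_scale (M : MaxwellModel N) {u : ℝ≥0 → ℝ} (hu : Measurable u)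
    (h1 : ∀ x, |u x| ≤ 1) (c : ℝ) (x : ℝ≥0) :
    IntegrableOn (fun τ : ℝ => M.Gam u (x * Real.toNNReal (τ ^ c))) (Set.Ioc 0 1) := by
  refine Integrable.of_bound (C := 1) ?_ (ae_of_all _ fun τ => M.abs_Gam_le_one h1 _)
  have := M.measurable_Gam hu
  exact Measurable.aestronglyMeasurable (by fun_prop)

/-- The Laplace transform of the smoothing transform. -/
theorem laplace_smooth (M : MaxwellModel N) (c : ℝ) {q : ℝ} (hq : 0 < q) (R : Measure ℝ≥0)
    [IsProbabilityMeasure R] (x : ℝ≥0) :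
    laplace (M.smooth c q R) ((x : ℝ) ^ q) =
      M.avgT c (fun x => laplace R ((x : ℝ) ^ q)) x := by
  have hu : Measurable fun x : ℝ≥0 => laplace R ((x : ℝ) ^ q) :=
    (continuous_laplace_comp R (g := fun x : ℝ≥0 => (x : ℝ) ^ q)
      (NNReal.continuous_coe.rpow_const fun _ => Or.inr hq.le)
      fun x => by positivity).measurable
  have hu1 : ∀ x : ℝ≥0, |laplace R ((x : ℝ) ^ q)| ≤ 1 := fun x =>
    abs_laplace_le_one R (by positivity)
  have hx : (0 : ℝ) ≤ (x : ℝ) ^ q := by positivity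
  unfold avgT Gam
  rw [integral_finsetSum]
  swap
  · intro i _
    refine Integrable.of_bound (C := M.α i) ?_ (ae_of_all _ fun τ => ?_)
    · have hg : Measurable fun τ : ℝ => x * Real.toNNReal (τ ^ c) := by fun_prop
      exact (((M.measurable_integral_prod_comp hu i).comp hg).const_mul _).aestronglyMeasurable
    · rw [Real.norm_eq_abs, abs_mul, abs_of_nonneg (M.α_nonneg i)]
      exact mul_le_of_le_one_right (M.α_nonneg i) (M.abs_integral_prod_comp_le hu1 i _)
  rw [laplace, smooth, integral_finsetSum_measure]
  swap
  · intro i _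
    have := Measure.isProbabilityMeasure_map
      (μ := (volume.restrict (Set.Ioc (0 : ℝ) 1)).prod
        ((M.A i).prod (Measure.pi fun _ : Fin (i.val + 1) => R)))
        (measurable_smooth_map (n := i.val + 1) c q).aemeasurable
    exact (integrable_exp_neg_mul _ hx).smul_measure ENNReal.ofReal_ne_top
  refine Finset.sum_congr rfl fun i _ => ?_
  rw [integral_smul_measure, ENNReal.toReal_ofReal (M.α_nonneg i), integral_const_mul, smul_eq_mul,
    integral_map (measurable_smooth_map c q).aemeasurable (by fun_prop)]
  congr 1
  have hbd : ∀ v : ℝ≥0, ‖Real.exp (-((v : ℝ) * (x : ℝ) ^ q))‖ ≤ 1 := fun v => by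
    rw [Real.norm_eq_abs, abs_of_pos (Real.exp_pos _), Real.exp_le_one_iff, Left.neg_nonpos_iff]
    positivity
  have hm : Measurable (fun z : ℝ × (Fin (i.val + 1) → ℝ≥0) × (Fin (i.val + 1) → ℝ≥0) =>
    Real.exp (-((Real.toNNReal (z.1 ^ (c * q)) * ∑ k, (z.2.1 k) ^ q * z.2.2 k : ℝ≥0) *
      (x : ℝ) ^ q))) := by
    have := measurable_smooth_map (n := i.val + 1) c q
    fun_prop
  rw [integral_prod _ (Integrable.of_bound (C := 1) hm.aestronglyMeasurable
    (ae_of_all _ fun z => hbd _))]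
  refine setIntegral_congr_fun measurableSet_Ioc fun τ hτ => ?_
  dsimp only
  refine (integral_prod _ (Integrable.of_bound (C := 1)
    (hm.comp (measurable_prodMk_left (x := τ))).aestronglyMeasurable
      (ae_of_all _ fun z => hbd _))).trans ?_
  refine integral_congr_ae (ae_of_all _ fun a => ?_)
  dsimp only
  -- Independence of the Xₖ: a product of transforms is the transform of the sum.
  have := integral_fintype_prod_eq_prod (𝕜 := ℝ) (μ := fun _ : Fin (i.val + 1) => R)
    (fun k (t : ℝ≥0) => Real.exp (-((t : ℝ) * ((a k * (x * Real.toNNReal (τ ^ c)) : ℝ≥0) : ℝ) ^ q)))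
  unfold laplace
  rw [← this]
  refine integral_congr_ae (ae_of_all _ fun t => ?_)
  dsimp only
  rw [← Real.exp_sum, Finset.sum_neg_distrib]
  refine congrArg Real.exp (congrArg Neg.neg ?_)
  push_cast
  rw [mul_assoc, Finset.sum_mul, Finset.mul_sum]
  refine Finset.sum_congr rfl fun k _ => ?_
  have hτ0 : 0 ≤ τ := hτ.1.le
  rw [Real.coe_toNNReal _ (by positivity), Real.coe_toNNReal _ (by positivity),
    Real.mul_rpow (by positivity) (by positivity), Real.mul_rpow (by positivity) (by positivity),
    Real.rpow_mul hτ0]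
  ring

end MaxwellModel

/-! ### Contraction in the distances weighted by x^s. -/

lemma abs_prod_sub_prod_le {ι : Type*} (s : Finset ι) {u v : ι → ℝ} (hu : ∀ i, |u i| ≤ 1)
    (hv : ∀ i, |v i| ≤ 1) : |∏ i ∈ s, u i - ∏ i ∈ s, v i| ≤ ∑ i ∈ s, |u i - v i| := by
  classical
  induction s using Finset.induction_on with
  | empty => simp
  | insert i s hi ih =>
    rw [Finset.prod_insert hi, Finset.prod_insert hi, Finset.sum_insert hi]
    have h1 : |∏ i ∈ s, u i| ≤ 1 := by
      rw [Finset.abs_prod]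
      exact Finset.prod_le_one (fun _ _ => abs_nonneg _) fun _ _ => hu _
    calc |u i * ∏ i ∈ s, u i - v i * ∏ i ∈ s, v i|
        = |(u i - v i) * ∏ i ∈ s, u i + v i * (∏ i ∈ s, u i - ∏ i ∈ s, v i)| := by ring_nf
      _ ≤ |u i - v i| * |∏ i ∈ s, u i| + |v i| * |∏ i ∈ s, u i - ∏ i ∈ s, v i| := by
          rw [← abs_mul, ← abs_mul]; exact abs_add_le _ _
      _ ≤ |u i - v i| * 1 + 1 * ∑ i ∈ s, |u i - v i| := by
          gcongr
          exact hv i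
      _ = _ := by ring

lemma integrableOn_rpow_Ioc {r : ℝ} (hr : -1 < r) :
    IntegrableOn (fun τ : ℝ => τ ^ r) (Set.Ioc 0 1) := by
  have := intervalIntegral.intervalIntegrable_rpow' (a := 0) (b := 1) hr
  rwa [intervalIntegrable_iff_integrableOn_Ioc_of_le zero_le_one] at this

lemma integral_rpow_Ioc {r : ℝ} (hr : -1 < r) :
    ∫ τ in Set.Ioc (0 : ℝ) 1, τ ^ r = (1 + r)⁻¹ := by
  rw [← intervalIntegral.integral_of_le zero_le_one, integral_rpow (Or.inl hr),
    Real.one_rpow, Real.zero_rpow (by linarith), sub_zero, one_div, add_comm]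

lemma measurable_apply_fin {n : ℕ} (k : Fin n) : Measurable fun a : Fin n → ℝ≥0 => a k :=
  measurable_pi_apply k

namespace MaxwellModel

variable {N : ℕ}

lemma exists_bound (M : MaxwellModel N) :
    ∃ r : ℝ, 0 < r ∧ ∀ i, ∀ᵐ a ∂(M.A i), ∀ k, ((a k : ℝ≥0) : ℝ) ≤ r := by
  obtain ⟨r, hr, h⟩ := M.bounded_support
  refine ⟨r, hr, fun i => (h i).mono fun a ha k => ?_⟩
  have h1 : ((a k : ℝ≥0) : ℝ) ^ 2 ≤ r ^ 2 :=
    (Finset.single_le_sum (f := fun k => ((a k : ℝ≥0) : ℝ) ^ 2) (fun _ _ => by positivity)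
      (Finset.mem_univ k)).trans ha
  exact le_of_sq_le_sq h1 hr.le

lemma integrable_rpow_apply (M : MaxwellModel N) {s : ℝ} (hs : 0 ≤ s) (i : Fin N)
    (k : Fin (i.val + 1)) : Integrable (fun a => ((a k : ℝ≥0) : ℝ) ^ s) (M.A i) := by
  obtain ⟨r, hr, h⟩ := M.exists_bound
  refine Integrable.of_bound (C := r ^ s) (Measurable.aestronglyMeasurable (by fun_prop))
    ((h i).mono fun a ha => ?_)
  rw [Real.norm_eq_abs, abs_of_nonneg (by positivity)]
  exact Real.rpow_le_rpow (by positivity) (ha k) hs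

lemma lam_eq (M : MaxwellModel N) {s : ℝ} (hs : 0 ≤ s) :
    M.lam s = ∑ i, M.α i * ∑ k, ∫ a, ((a k : ℝ≥0) : ℝ) ^ s ∂(M.A i) := by
  have hint : ∀ i : Fin N, ∀ k : Fin (i.val + 1),
      Integrable (fun b : ℝ≥0 => (b : ℝ) ^ s) ((M.A i).map fun a => a k) := fun i k => by
    rw [integrable_map_measure (Measurable.aestronglyMeasurable (by fun_prop)) (measurable_apply_fin k).aemeasurable]
    exact M.integrable_rpow_apply hs i k
  rw [lam, K, integral_finsetSum_measure]
  · refine Finset.sum_congr rfl fun i _ => ?_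
    rw [integral_smul_measure, ENNReal.toReal_ofReal (M.α_nonneg i), smul_eq_mul,
      integral_finsetSum_measure fun k _ => hint i k]
    congr 1
    refine Finset.sum_congr rfl fun k _ => ?_
    rw [integral_map (measurable_apply_fin k).aemeasurable (Measurable.aestronglyMeasurable (by fun_prop))]
  · intro i _
    refine Integrable.smul_measure ?_ ENNReal.ofReal_ne_top
    rw [integrable_finsetSum_measure]
    exact fun k _ => hint i k

lemma lam_nonneg (M : MaxwellModel N) (s : ℝ) : 0 ≤ M.lam s :=
  integral_nonneg fun _ => by positivity

lemma ofReal_lam (M : MaxwellModel N) {s : ℝ} (hs : 0 ≤ s) :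
    ENNReal.ofReal (M.lam s) = ∑ i, ENNReal.ofReal (M.α i) *
      ∑ k, ∫⁻ a, ENNReal.ofReal (((a k : ℝ≥0) : ℝ) ^ s) ∂(M.A i) := by
  have hnn : ∀ i : Fin N, ∀ k : Fin (i.val + 1), 0 ≤ ∫ a, ((a k : ℝ≥0) : ℝ) ^ s ∂(M.A i) :=
    fun i k => integral_nonneg fun _ => by positivity
  rw [M.lam_eq hs, ENNReal.ofReal_sum_of_nonneg fun i _ =>
    mul_nonneg (M.α_nonneg i) (Finset.sum_nonneg fun k _ => hnn i k)]
  refine Finset.sum_congr rfl fun i _ => ?_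
  rw [ENNReal.ofReal_mul (M.α_nonneg i), ENNReal.ofReal_sum_of_nonneg fun k _ => hnn i k]
  congr 1
  refine Finset.sum_congr rfl fun k _ => ?_
  rw [ofReal_integral_eq_lintegral_ofReal (M.integrable_rpow_apply hs i k)
    (ae_of_all _ fun _ => by positivity)]

/-- Telescoping the product bounds Γ by its linearization: the factor with index k contributes C
aₖ^s y^s, and summing over n and k produces λ(s). -/
lemma abs_Gam_sub_le (M : MaxwellModel N) {u v : ℝ≥0 → ℝ} (hu : Measurable u) (hv : Measurable v)
    (hu1 : ∀ x, |u x| ≤ 1) (hv1 : ∀ x, |v x| ≤ 1) {C s : ℝ} (hs : 0 ≤ s)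
    (h : ∀ x : ℝ≥0, |u x - v x| ≤ C * (x : ℝ) ^ s) (y : ℝ≥0) :
    |M.Gam u y - M.Gam v y| ≤ C * M.lam s * (y : ℝ) ^ s := by
  rw [M.lam_eq hs, Finset.mul_sum, Finset.sum_mul]
  unfold Gam
  rw [← Finset.sum_sub_distrib]
  refine (Finset.abs_sum_le_sum_abs _ _).trans (Finset.sum_le_sum fun i _ => ?_)
  rw [← mul_sub, abs_mul, abs_of_nonneg (M.α_nonneg i), mul_left_comm, mul_assoc]
  refine mul_le_mul_of_nonneg_left ?_ (M.α_nonneg i)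
  rw [← integral_sub (M.integrable_prod_comp hu hu1 i y) (M.integrable_prod_comp hv hv1 i y),
    Finset.mul_sum, Finset.sum_mul]
  have hint : ∀ k : Fin (i.val + 1), Integrable
      (fun a : Fin (i.val + 1) → ℝ≥0 => C * ((a k : ℝ≥0) : ℝ) ^ s * (y : ℝ) ^ s) (M.A i) :=
    fun k => ((M.integrable_rpow_apply hs i k).const_mul C).mul_const _
  calc |∫ a, (∏ k, u (a k * y) - ∏ k, v (a k * y)) ∂(M.A i)|
      ≤ ∫ a, ∑ k, C * ((a k : ℝ≥0) : ℝ) ^ s * (y : ℝ) ^ s ∂(M.A i) := by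
        rw [← Real.norm_eq_abs]
        refine norm_integral_le_of_norm_le (integrable_finsetSum _ fun k _ => hint k)
          (ae_of_all _ fun a => ?_)
        rw [Real.norm_eq_abs]
        refine (abs_prod_sub_prod_le _ (fun k => hu1 _) fun k => hv1 _).trans
          (Finset.sum_le_sum fun k _ => (h _).trans_eq ?_)
        rw [NNReal.coe_mul, Real.mul_rpow (by positivity) (by positivity), mul_assoc]
    _ = _ := by
        rw [integral_finsetSum _ fun k _ => hint k]
        exact Finset.sum_congr rfl fun k _ => by rw [integral_mul_const, integral_const_mul]

lemma toNNReal_scale_rpow {c s τ : ℝ} (hτ : 0 ≤ τ) (x : ℝ≥0) :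
    ((x * Real.toNNReal (τ ^ c) : ℝ≥0) : ℝ) ^ s = (x : ℝ) ^ s * τ ^ (c * s) := by
  rw [NNReal.coe_mul, Real.coe_toNNReal _ (by positivity),
    Real.mul_rpow (by positivity) (by positivity), Real.rpow_mul hτ]

/-- The average over τ adds the factor ∫₀¹ τ^{cs} dτ = 1/(1 + cs) to that of Γ. -/
theorem abs_avgT_sub_le (M : MaxwellModel N) {u v : ℝ≥0 → ℝ} (hu : Measurable u)
    (hv : Measurable v) (hu1 : ∀ x, |u x| ≤ 1) (hv1 : ∀ x, |v x| ≤ 1) {c C s : ℝ} (hs : 0 ≤ s)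
    (hcs : -1 < c * s) (h : ∀ x : ℝ≥0, |u x - v x| ≤ C * (x : ℝ) ^ s) (x : ℝ≥0) :
    |M.avgT c u x - M.avgT c v x| ≤ C * (M.lam s / (1 + c * s)) * (x : ℝ) ^ s := by
  unfold avgT
  rw [← integral_sub (M.integrable_Gam_scale hu hu1 c x) (M.integrable_Gam_scale hv hv1 c x)]
  calc |∫ τ in Set.Ioc (0 : ℝ) 1, (M.Gam u (x * Real.toNNReal (τ ^ c)) -
          M.Gam v (x * Real.toNNReal (τ ^ c)))|
      ≤ ∫ τ in Set.Ioc (0 : ℝ) 1, C * M.lam s * (x : ℝ) ^ s * τ ^ (c * s) := by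
        rw [← Real.norm_eq_abs]
        refine norm_integral_le_of_norm_le ((integrableOn_rpow_Ioc hcs).const_mul _)
          (ae_restrict_of_forall_mem measurableSet_Ioc fun τ hτ => ?_)
        rw [Real.norm_eq_abs]
        refine (M.abs_Gam_sub_le hu hv hu1 hv1 hs h _).trans_eq ?_
        rw [toNNReal_scale_rpow hτ.1.le, mul_assoc _ _ (τ ^ (c * s))]
    _ = _ := by
        rw [integral_const_mul, integral_rpow_Ioc hcs]
        ring

end MaxwellModel

/-! ### Expansions at the origin and moments of the smoothing transform. -/

/-- For y ≤ 1 the error is at most y², for y ≥ 1 at most y; any power between 1 and 2 dominates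
both. -/
lemma abs_exp_neg_sub_le {y σ : ℝ} (hy : 0 ≤ y) (h1 : 1 ≤ σ) (h2 : σ ≤ 2) :
    |Real.exp (-y) - (1 - y)| ≤ y ^ σ := by
  have h0 : 0 ≤ Real.exp (-y) - (1 - y) := by
    have := Real.add_one_le_exp (-y); linarith
  rw [abs_of_nonneg h0]
  rcases le_total y 1 with h | h
  · have h3 := (Real.abs_exp_sub_one_sub_id_le (x := -y) (by rwa [abs_neg, abs_of_nonneg hy]))
    have h4 : y ^ (2 : ℝ) ≤ y ^ σ := by
      rcases hy.eq_or_lt with rfl | hy'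
      · rw [Real.zero_rpow (by norm_num), Real.zero_rpow (by linarith)]
      · exact Real.rpow_le_rpow_of_exponent_ge hy' h h2
    rw [Real.rpow_two] at h4
    have := (le_abs_self _).trans h3
    nlinarith
  · have h3 : y ^ (1 : ℝ) ≤ y ^ σ := Real.rpow_le_rpow_of_exponent_le h h1
    rw [Real.rpow_one] at h3
    have : Real.exp (-y) ≤ 1 := by rw [Real.exp_le_one_iff]; linarith
    linarith

lemma integrable_rpow_of_laplaceMoment {R : Measure ℝ≥0} {σ : ℝ}
    (h : laplaceMoment R σ < ∞) : Integrable (fun v : ℝ≥0 => (v : ℝ) ^ σ) R := by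
  refine ⟨Measurable.aestronglyMeasurable (by fun_prop), ?_⟩
  rw [hasFiniteIntegral_iff_ofReal (ae_of_all _ fun v => by positivity)]
  exact h

lemma integral_rpow_eq_toReal_laplaceMoment (R : Measure ℝ≥0) (σ : ℝ) :
    ∫ v : ℝ≥0, (v : ℝ) ^ σ ∂(R) = (laplaceMoment R σ).toReal := by
  rw [integral_eq_lintegral_of_nonneg_ae (ae_of_all _ fun v => by positivity)
    (Measurable.aestronglyMeasurable (by fun_prop))]
  rfl

/-- Expansion at `0` of the Laplace transform of a probability measure of mean one. -/
lemma abs_laplace_sub_le {Q : Measure ℝ≥0} [IsProbabilityMeasure Q] {σ : ℝ} (h1 : 1 ≤ σ)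
    (h2 : σ ≤ 2) (hQ1 : laplaceMoment Q 1 = 1) (hQ : laplaceMoment Q σ < ∞) {y : ℝ}
    (hy : 0 ≤ y) : |laplace Q y - (1 - y)| ≤ (laplaceMoment Q σ).toReal * y ^ σ := by
  have hi1 : Integrable (fun v : ℝ≥0 => (v : ℝ)) Q := by
    have := integrable_rpow_of_laplaceMoment (R := Q) (σ := 1) (by rw [hQ1]; simp)
    simpa using this
  have hm1 : ∫ v : ℝ≥0, (v : ℝ) ∂Q = 1 := by
    have := integral_rpow_eq_toReal_laplaceMoment Q 1
    rw [hQ1] at this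
    simpa using this
  have hlin : Integrable (fun v : ℝ≥0 => 1 - (v : ℝ) * y) Q :=
    (integrable_const _).sub (hi1.mul_const _)
  have he : laplace Q y - (1 - y) =
      ∫ v : ℝ≥0, (Real.exp (-((v : ℝ) * y)) - (1 - (v : ℝ) * y)) ∂Q := by
    rw [integral_sub (integrable_exp_neg_mul Q hy) hlin,
      integral_sub (integrable_const _) (hi1.mul_const _), integral_mul_const, hm1]
    simp [laplace]
  rw [he, ← Real.norm_eq_abs (∫ v : ℝ≥0, _ ∂_), ← integral_rpow_eq_toReal_laplaceMoment,
    ← integral_mul_const]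
  refine norm_integral_le_of_norm_le ((integrable_rpow_of_laplaceMoment hQ).mul_const _)
    (ae_of_all _ fun v => ?_)
  rw [Real.norm_eq_abs, ← Real.mul_rpow (by positivity) hy]
  exact abs_exp_neg_sub_le (by positivity) h1 h2

lemma lintegral_pi_apply {n : ℕ} (R : Measure ℝ≥0) [IsProbabilityMeasure R] (k : Fin n)
    {f : ℝ≥0 → ℝ≥0∞} (hf : Measurable f) :
    ∫⁻ t, f (t k) ∂(Measure.pi fun _ : Fin n => R) = ∫⁻ v, f v ∂(R) :=
  (measurePreserving_eval (fun _ : Fin n => R) k).lintegral_comp hf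

lemma lintegral_rpow_Ioc {r : ℝ} (hr : -1 < r) :
    ∫⁻ τ in Set.Ioc (0 : ℝ) 1, ENNReal.ofReal (τ ^ r) = ENNReal.ofReal (1 + r)⁻¹ := by
  rw [← integral_rpow_Ioc hr, ofReal_integral_eq_lintegral_ofReal (integrableOn_rpow_Ioc hr)
    (ae_restrict_of_forall_mem measurableSet_Ioc fun τ hτ => Real.rpow_nonneg hτ.1.le _)]

lemma lintegral_Ioc_rpow_eq_top {b r : ℝ} (hb : 0 < b) (hr : r ≤ -1) :
    ∫⁻ x in Set.Ioc (0 : ℝ) b, ENNReal.ofReal (x ^ r) = ∞ := by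
  by_contra h
  have hi : IntegrableOn (fun τ : ℝ => τ ^ r) (Set.Ioc 0 b) := by
    refine ⟨Measurable.aestronglyMeasurable (by fun_prop), ?_⟩
    rw [hasFiniteIntegral_iff_ofReal
      (ae_restrict_of_forall_mem measurableSet_Ioc fun τ hτ => Real.rpow_nonneg hτ.1.le _)]
    exact lt_top_iff_ne_top.2 h
  rw [integrableOn_Ioc_iff_integrableOn_Ioo, intervalIntegral.integrableOn_Ioo_rpow_iff hb] at hi
  linarith

/-- Comparison with the largest summand, which works for σ below and above 1 alike. -/
lemma sum_rpow_le_mul_sum_rpow {n : ℕ} {y : Fin n → ℝ≥0} {σ : ℝ} (hσ : 0 < σ) :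
    ((∑ k, y k : ℝ≥0) : ℝ) ^ σ ≤ (n : ℝ) ^ σ * ∑ k, (y k : ℝ) ^ σ := by
  rcases n.eq_zero_or_pos with rfl | hn
  · simp [Real.zero_rpow hσ.ne']
  have : Nonempty (Fin n) := ⟨⟨0, hn⟩⟩
  obtain ⟨j, hj⟩ := Finite.exists_max y
  have h1 : ((∑ k, y k : ℝ≥0) : ℝ) ≤ n * (y j : ℝ) := by
    push_cast
    have := Finset.sum_le_card_nsmul Finset.univ (fun k => (y k : ℝ)) (y j) fun k _ => by
      exact_mod_cast hj k
    simpa using this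
  calc ((∑ k, y k : ℝ≥0) : ℝ) ^ σ ≤ (n * (y j : ℝ)) ^ σ := Real.rpow_le_rpow (by positivity) h1 hσ.le
    _ = (n : ℝ) ^ σ * (y j : ℝ) ^ σ := Real.mul_rpow (by positivity) (by positivity)
    _ ≤ _ := by
      gcongr
      exact Finset.single_le_sum (f := fun k => (y k : ℝ) ^ σ) (fun _ _ => by positivity)
        (Finset.mem_univ j)

namespace MaxwellModel

variable {N : ℕ}

/-- The moment of order `σ` of the un-averaged sum `∑ₖ aₖ^q Xₖ`. -/
noncomputable def sumMoment (M : MaxwellModel N) (q : ℝ) (R : Measure ℝ≥0) (σ : ℝ) : ℝ≥0∞ :=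
  ∑ i, ENNReal.ofReal (M.α i) * ∫⁻ a, ∫⁻ t,
    ENNReal.ofReal (((∑ k, (a k) ^ q * t k : ℝ≥0) : ℝ) ^ σ)
      ∂(Measure.pi fun _ : Fin (i.val + 1) => R) ∂(M.A i)

lemma laplaceMoment_smooth (M : MaxwellModel N) (c q : ℝ) (R : Measure ℝ≥0)
    [IsProbabilityMeasure R] (σ : ℝ) :
    laplaceMoment (M.smooth c q R) σ =
      (∫⁻ τ in Set.Ioc (0 : ℝ) 1, ENNReal.ofReal (τ ^ (c * q * σ))) * M.sumMoment q R σ := by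
  rw [laplaceMoment, M.lintegral_smooth c q R (by fun_prop), sumMoment, Finset.mul_sum]
  refine Finset.sum_congr rfl fun i _ => ?_
  rw [mul_left_comm]
  congr 1
  rw [← lintegral_mul_const _ (by fun_prop)]
  refine setLIntegral_congr_fun measurableSet_Ioc fun τ hτ => ?_
  have hτ0 : 0 ≤ τ := hτ.1.le
  rw [← lintegral_const_mul' _ _ ENNReal.ofReal_ne_top]
  refine lintegral_congr fun a => ?_
  rw [← lintegral_const_mul' _ _ ENNReal.ofReal_ne_top]
  refine lintegral_congr fun t => ?_
  rw [NNReal.coe_mul, Real.coe_toNNReal _ (by positivity),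
    Real.mul_rpow (by positivity) (by positivity), ← Real.rpow_mul hτ0,
    ENNReal.ofReal_mul (by positivity)]

/-- The sum over `n`, `k` of the moments of the single summands `aₖ^q Xₖ`. -/
lemma sum_lintegral_rpow (M : MaxwellModel N) {q σ : ℝ} (hq : 0 ≤ q) (hσ : 0 ≤ σ)
    (R : Measure ℝ≥0) [IsProbabilityMeasure R] :
    ∑ i, ENNReal.ofReal (M.α i) * ∫⁻ a, ∫⁻ t,
      ENNReal.ofReal (∑ k, (((a k) ^ q * t k : ℝ≥0) : ℝ) ^ σ)
        ∂(Measure.pi fun _ : Fin (i.val + 1) => R) ∂(M.A i) =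
    ENNReal.ofReal (M.lam (q * σ)) * laplaceMoment R σ := by
  rw [M.ofReal_lam (by positivity), Finset.sum_mul]
  refine Finset.sum_congr rfl fun i _ => ?_
  rw [mul_assoc]
  congr 1
  rw [Finset.sum_mul]
  simp_rw [ENNReal.ofReal_sum_of_nonneg (fun (k : Fin (i.val + 1)) _ =>
    Real.rpow_nonneg (NNReal.coe_nonneg _) σ)]
  have h1 : ∀ a : Fin (i.val + 1) → ℝ≥0,
      ∫⁻ t, ∑ k, ENNReal.ofReal ((((a k) ^ q * t k : ℝ≥0) : ℝ) ^ σ)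
        ∂(Measure.pi fun _ : Fin (i.val + 1) => R) =
      ∑ k, ENNReal.ofReal ((a k : ℝ) ^ (q * σ)) * laplaceMoment R σ := fun a => by
    rw [lintegral_finsetSum _ fun k _ => by fun_prop]
    refine Finset.sum_congr rfl fun k _ => ?_
    rw [lintegral_pi_apply R k (f := fun v => ENNReal.ofReal ((((a k) ^ q * v : ℝ≥0) : ℝ) ^ σ))
      (by fun_prop), laplaceMoment, ← lintegral_const_mul _ (by fun_prop)]
    refine lintegral_congr fun v => ?_
    rw [← ENNReal.ofReal_mul (by positivity), NNReal.coe_mul, NNReal.coe_rpow,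
      Real.mul_rpow (by positivity) (by positivity), Real.rpow_mul (by positivity)]
  simp_rw [h1]
  rw [lintegral_finsetSum _ fun k _ => by fun_prop]
  exact Finset.sum_congr rfl fun k _ => by rw [lintegral_mul_const _ (by fun_prop)]

lemma sumMoment_one (M : MaxwellModel N) {q : ℝ} (hq : 0 ≤ q) (R : Measure ℝ≥0)
    [IsProbabilityMeasure R] :
    M.sumMoment q R 1 = ENNReal.ofReal (M.lam q) * laplaceMoment R 1 := by
  have := M.sum_lintegral_rpow hq zero_le_one R
  rw [mul_one] at this
  rw [← this, sumMoment]
  simp_rw [Real.rpow_one, ← NNReal.coe_sum]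

lemma sumMoment_lt_top (M : MaxwellModel N) {q σ : ℝ} (hq : 0 ≤ q) (hσ : 0 < σ)
    {R : Measure ℝ≥0} [IsProbabilityMeasure R] (h : laplaceMoment R σ < ∞) :
    M.sumMoment q R σ < ∞ := by
  refine lt_of_le_of_lt ?_ (ENNReal.mul_lt_top (ENNReal.ofReal_lt_top (r := (N : ℝ) ^ σ))
    (ENNReal.mul_lt_top (ENNReal.ofReal_lt_top (r := M.lam (q * σ))) h))
  rw [← M.sum_lintegral_rpow hq hσ.le R, Finset.mul_sum, sumMoment]
  refine Finset.sum_le_sum fun i _ => ?_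
  rw [mul_left_comm]
  gcongr
  rw [← lintegral_const_mul' _ _ ENNReal.ofReal_ne_top]
  refine lintegral_mono fun a => ?_
  rw [← lintegral_const_mul' _ _ ENNReal.ofReal_ne_top]
  refine lintegral_mono fun t => ?_
  rw [← ENNReal.ofReal_mul (by positivity)]
  refine ENNReal.ofReal_le_ofReal ((sum_rpow_le_mul_sum_rpow hσ).trans ?_)
  gcongr
  exact_mod_cast i.isLt

lemma laplaceMoment_smooth_lt_top (M : MaxwellModel N) {c q σ : ℝ} (hq : 0 ≤ q) (hσ : 0 < σ)
    (hc : -1 < c * q * σ) {R : Measure ℝ≥0} [IsProbabilityMeasure R]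
    (h : laplaceMoment R σ < ∞) : laplaceMoment (M.smooth c q R) σ < ∞ := by
  rw [M.laplaceMoment_smooth, lintegral_rpow_Ioc hc]
  exact ENNReal.mul_lt_top ENNReal.ofReal_lt_top (M.sumMoment_lt_top hq hσ h)

lemma exists_strictAntiOn_of_lt_critExp (M : MaxwellModel N) {p : ℝ}
    (h : ENNReal.ofReal p < M.critExp) : ∃ r, p < r ∧ StrictAntiOn M.mu (Set.Ioc 0 r) := by
  obtain ⟨_, ⟨r, ⟨hr, hr'⟩, rfl⟩, h2⟩ := lt_sSup_iff.1 h
  exact ⟨r, (ENNReal.ofReal_lt_ofReal_iff hr).1 h2, hr'⟩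

lemma lam_eq_one_add (M : MaxwellModel N) {s : ℝ} (hs : s ≠ 0) : M.lam s = 1 + M.mu s * s := by
  rw [mu]; field_simp; ring

lemma lam_lt_of_mu_lt (M : MaxwellModel N) {c s : ℝ} (hs : 0 < s) (h : M.mu s < c) :
    M.lam s < 1 + c * s := by
  rw [M.lam_eq_one_add hs.ne']; gcongr

/-- Since λ ≥ 0, the contraction condition already contains the integrability of τ^{cs} at 0. -/
lemma neg_one_lt_of_mu_lt (M : MaxwellModel N) {c s : ℝ} (hs : 0 < s) (h : M.mu s < c) :
    -1 < c * s := by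
  have := M.lam_lt_of_mu_lt hs h
  have := M.lam_nonneg s
  linarith

lemma neg_one_lt_mul_of_le {c s p : ℝ} (hp : 0 < p) (hps : p ≤ s) (h : -1 < c * s) :
    -1 < c * p := by
  rcases le_total 0 c with hc | hc
  · have : 0 ≤ c * p := by positivity
    linarith
  · nlinarith

/-- This is what singles out c = μ(p): λ(p) = 1 + pμ(p) cancels the factor coming from the average
over τ, so the mean is preserved. -/
lemma laplaceMoment_one_smooth (M : MaxwellModel N) {p : ℝ} (hp : 0 < p)
    (h : -1 < M.mu p * p) (R : Measure ℝ≥0) [IsProbabilityMeasure R] :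
    laplaceMoment (M.smooth (M.mu p) p R) 1 = laplaceMoment R 1 := by
  rw [M.laplaceMoment_smooth, mul_one, lintegral_rpow_Ioc h, M.sumMoment_one hp.le, ← mul_assoc,
    M.lam_eq_one_add hp.ne', ← ENNReal.ofReal_mul (by rw [inv_nonneg]; linarith),
    inv_mul_cancel₀ (by linarith), ENNReal.ofReal_one, one_mul]

lemma laplaceMoment_dirac_one (σ : ℝ) : laplaceMoment (Measure.dirac 1) σ = 1 := by
  simp [laplaceMoment]

lemma laplace_dirac_one (y : ℝ) : laplace (Measure.dirac 1) y = Real.exp (-y) := by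
  simp [laplace]

/-- In the variable x^p, both functions are transforms of probability measures of mean one with a
finite moment of order s/p ∈ [1, 2]; hence both are 1 - x^p + O(x^s). -/
lemma exists_abs_avgT_exp_sub_le (M : MaxwellModel N) {p s : ℝ} (hp : 0 < p) (hps : p ≤ s)
    (hs : s ≤ 2 * p) (hcs : -1 < M.mu p * s) : ∃ C : ℝ, ∀ x : ℝ≥0,
    |M.avgT (M.mu p) (fun x : ℝ≥0 => Real.exp (-(x : ℝ) ^ p)) x - Real.exp (-(x : ℝ) ^ p)|
      ≤ C * (x : ℝ) ^ s := by
  have h1 : 1 ≤ s / p := by rwa [one_le_div hp]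
  have h2 : s / p ≤ 2 := by rwa [div_le_iff₀ hp]
  have hσ : M.mu p * p * (s / p) = M.mu p * s := by field_simp
  set Q := M.smooth (M.mu p) p (Measure.dirac 1) with hQ
  have hm1 : laplaceMoment Q 1 = 1 := by
    rw [hQ, M.laplaceMoment_one_smooth hp (neg_one_lt_mul_of_le hp hps hcs),
      laplaceMoment_dirac_one]
  have hmσ : laplaceMoment Q (s / p) < ∞ :=
    M.laplaceMoment_smooth_lt_top hp.le (by positivity) (by rwa [hσ])
      (by rw [laplaceMoment_dirac_one]; simp)
  refine ⟨(laplaceMoment Q (s / p)).toReal + 1, fun x => ?_⟩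
  have hx : (0 : ℝ) ≤ (x : ℝ) ^ p := by positivity
  have hxs : ((x : ℝ) ^ p) ^ (s / p) = (x : ℝ) ^ s := by
    rw [← Real.rpow_mul (by positivity)]; congr 1; field_simp
  have e1 := M.laplace_smooth (M.mu p) hp (Measure.dirac 1) x
  simp_rw [laplace_dirac_one] at e1
  rw [← e1]
  have b1 := abs_laplace_sub_le h1 h2 hm1 hmσ hx
  have b2 := abs_exp_neg_sub_le hx h1 h2
  rw [hxs] at b1 b2
  rw [add_mul, one_mul]
  refine (abs_sub_le _ (1 - (x : ℝ) ^ p) _).trans (add_le_add b1 ?_)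
  rwa [abs_sub_comm]

end MaxwellModel

/-! ### Iteration from e^{-x^p}: convergence, representation and uniqueness of the profile. -/

/-- The function `x ↦ e^{-x^p}`. -/
noncomputable def expPow (p : ℝ) (x : ℝ≥0) : ℝ := Real.exp (-(x : ℝ) ^ p)

lemma abs_expPow_le_one (p : ℝ) (x : ℝ≥0) : |expPow p x| ≤ 1 := by
  rw [expPow, abs_of_pos (Real.exp_pos _), Real.exp_le_one_iff, Left.neg_nonpos_iff]
  positivity

lemma measurable_expPow (p : ℝ) : Measurable (expPow p) := by
  unfold expPow; fun_prop

lemma abs_expPow_sub_le {p s : ℝ} (hp : 0 < p) (hps : p ≤ s) (hs : s ≤ 2 * p) (x : ℝ≥0) :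
    |expPow p x - (1 - (x : ℝ) ^ p)| ≤ (x : ℝ) ^ s := by
  have h1 : 1 ≤ s / p := by rwa [one_le_div hp]
  have h2 : s / p ≤ 2 := by rwa [div_le_iff₀ hp]
  have hxs : ((x : ℝ) ^ p) ^ (s / p) = (x : ℝ) ^ s := by
    rw [← Real.rpow_mul (by positivity)]; congr 1; field_simp
  have := abs_exp_neg_sub_le (y := (x : ℝ) ^ p) (by positivity) h1 h2
  rwa [hxs] at this

lemma measurable_laplace_rpow (R : Measure ℝ≥0) [IsProbabilityMeasure R] {q : ℝ} (hq : 0 < q) :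
    Measurable fun x : ℝ≥0 => laplace R ((x : ℝ) ^ q) :=
  (continuous_laplace_comp R (g := fun x : ℝ≥0 => (x : ℝ) ^ q)
      (NNReal.continuous_coe.rpow_const fun _ => Or.inr hq.le) fun x => by positivity).measurable

namespace MaxwellModel

variable {N : ℕ}

lemma measurable_avgT (M : MaxwellModel N) (c : ℝ) {u : ℝ≥0 → ℝ} (hu : Measurable u) :
    Measurable (M.avgT c u) := by
  have h : Measurable fun z : ℝ≥0 × ℝ => M.Gam u (z.1 * Real.toNNReal (z.2 ^ c)) := by
    have := M.measurable_Gam hu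
    fun_prop
  exact h.stronglyMeasurable.integral_prod_right'.measurable

lemma abs_avgT_le_one (M : MaxwellModel N) (c : ℝ) {u : ℝ≥0 → ℝ} (h1 : ∀ x, |u x| ≤ 1)
    (x : ℝ≥0) : |M.avgT c u x| ≤ 1 := by
  have := norm_integral_le_of_norm_le_const (μ := volume.restrict (Set.Ioc (0 : ℝ) 1)) (C := 1)
    (f := fun τ => M.Gam u (x * Real.toNNReal (τ ^ c))) (ae_of_all _ fun a => M.abs_Gam_le_one h1 _)
  simpa [avgT] using this

lemma measurable_iterate_avgT (M : MaxwellModel N) (c : ℝ) {u : ℝ≥0 → ℝ} (hu : Measurable u)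
    (n : ℕ) : Measurable ((M.avgT c)^[n] u) := by
  induction n with
  | zero => simpa
  | succ n ih => rw [Function.iterate_succ_apply']; exact M.measurable_avgT c ih

lemma abs_iterate_avgT_le_one (M : MaxwellModel N) (c : ℝ) {u : ℝ≥0 → ℝ} (h1 : ∀ x, |u x| ≤ 1)
    (n : ℕ) (x : ℝ≥0) : |(M.avgT c)^[n] u x| ≤ 1 := by
  induction n generalizing x with
  | zero => exact h1 x
  | succ n ih => rw [Function.iterate_succ_apply']; exact M.abs_avgT_le_one c ih x

instance isProbabilityMeasure_iterate_smooth (M : MaxwellModel N) (c q : ℝ) (R : Measure ℝ≥0)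
    [IsProbabilityMeasure R] (n : ℕ) : IsProbabilityMeasure ((M.smooth c q)^[n] R) := by
  induction n with
  | zero => simpa
  | succ n ih => rw [Function.iterate_succ_apply']; infer_instance

lemma laplace_iterate_smooth (M : MaxwellModel N) (c : ℝ) {q : ℝ} (hq : 0 < q) (R : Measure ℝ≥0)
    [IsProbabilityMeasure R] (n : ℕ) (x : ℝ≥0) :
    laplace ((M.smooth c q)^[n] R) ((x : ℝ) ^ q) =
      (M.avgT c)^[n] (fun x => laplace R ((x : ℝ) ^ q)) x := by
  induction n generalizing x with
  | zero => rfl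
  | succ n ih =>
    rw [Function.iterate_succ_apply', Function.iterate_succ_apply', M.laplace_smooth c hq]
    congr 1
    exact funext ih

lemma abs_iterate_avgT_sub_le (M : MaxwellModel N) {u v : ℝ≥0 → ℝ} (hu : Measurable u)
    (hv : Measurable v) (hu1 : ∀ x, |u x| ≤ 1) (hv1 : ∀ x, |v x| ≤ 1) {c C s : ℝ} (hs : 0 ≤ s)
    (hcs : -1 < c * s) (h : ∀ x : ℝ≥0, |u x - v x| ≤ C * (x : ℝ) ^ s) (n : ℕ) (x : ℝ≥0) :
    |(M.avgT c)^[n] u x - (M.avgT c)^[n] v x| ≤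
      C * (M.lam s / (1 + c * s)) ^ n * (x : ℝ) ^ s := by
  induction n generalizing x with
  | zero => simpa using h x
  | succ n ih =>
    rw [Function.iterate_succ_apply', Function.iterate_succ_apply', pow_succ, ← mul_assoc]
    exact M.abs_avgT_sub_le (M.measurable_iterate_avgT c hu n) (M.measurable_iterate_avgT c hv n)
      (M.abs_iterate_avgT_le_one c hu1 n) (M.abs_iterate_avgT_le_one c hv1 n) hs hcs ih x

lemma contraction_nonneg (M : MaxwellModel N) {c s : ℝ} (hcs : -1 < c * s) :
    0 ≤ M.lam s / (1 + c * s) :=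
  div_nonneg (M.lam_nonneg s) (by linarith)

lemma contraction_lt_one (M : MaxwellModel N) {c s : ℝ} (hs : 0 < s) (h : M.mu s < c) :
    M.lam s / (1 + c * s) < 1 := by
  rw [div_lt_one (by linarith [M.neg_one_lt_of_mu_lt hs h])]
  exact M.lam_lt_of_mu_lt hs h

lemma tendsto_contraction (M : MaxwellModel N) {c s : ℝ} (hs : 0 < s) (h : M.mu s < c)
    (a b : ℝ) : Tendsto (fun n : ℕ => a * (M.lam s / (1 + c * s)) ^ n * b) atTop (𝓝 0) := by
  simpa using ((tendsto_pow_atTop_nhds_zero_of_lt_one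
    (M.contraction_nonneg (M.neg_one_lt_of_mu_lt hs h))
    (M.contraction_lt_one hs h)).const_mul a).mul_const b

section Limit

variable (M : MaxwellModel N) {p s : ℝ}

/-- The constant D = C/(1 - θ) solves θD + C = D, so the bound reproduces itself. -/
lemma exists_abs_iterate_sub_expPow_le (hp : 0 < p) (hps : p ≤ s) (hs : s ≤ 2 * p)
    (hmu : M.mu s < M.mu p) : ∃ D : ℝ, ∀ (n : ℕ) (x : ℝ≥0),
      |(M.avgT (M.mu p))^[n] (expPow p) x - expPow p x| ≤ D * (x : ℝ) ^ s := by
  have hs0 : 0 < s := by linarith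
  have hcs := M.neg_one_lt_of_mu_lt hs0 hmu
  obtain ⟨C, hC⟩ := M.exists_abs_avgT_exp_sub_le hp hps hs hcs
  have hθ := M.contraction_lt_one hs0 hmu
  set θ := M.lam s / (1 + M.mu p * s) with hθd
  have hC0 : 0 ≤ C := by simpa using (abs_nonneg _).trans (hC 1)
  refine ⟨C / (1 - θ), fun n => ?_⟩
  have hθ1 : 0 < 1 - θ := by linarith
  induction n with
  | zero => intro x; simp only [Function.iterate_zero, id, sub_self, abs_zero]; positivity
  | succ n ih =>
    intro x
    rw [Function.iterate_succ_apply']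
    have h1 := M.abs_avgT_sub_le (M.measurable_iterate_avgT (M.mu p) (measurable_expPow p) n)
      (measurable_expPow p) (M.abs_iterate_avgT_le_one (M.mu p) (abs_expPow_le_one p) n)
      (abs_expPow_le_one p) hs0.le hcs ih x
    refine (abs_sub_le _ (M.avgT (M.mu p) (expPow p) x) _).trans
      ((add_le_add h1 (hC x)).trans_eq ?_)
    rw [← hθd]
    field_simp
    ring

lemma tendsto_iterate_expPow (hp : 0 < p) (hps : p ≤ s) (hs : s ≤ 2 * p)
    (hmu : M.mu s < M.mu p) : ∃ ψ : ℝ≥0 → ℝ, ∀ x,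
      Tendsto (fun n => (M.avgT (M.mu p))^[n] (expPow p) x) atTop (𝓝 (ψ x)) := by
  have hs0 : 0 < s := by linarith
  have hcs := M.neg_one_lt_of_mu_lt hs0 hmu
  obtain ⟨D, hD⟩ := M.exists_abs_iterate_sub_expPow_le hp hps hs hmu
  have key : ∀ x, ∃ l, Tendsto (fun n => (M.avgT (M.mu p))^[n] (expPow p) x) atTop (𝓝 l) := by
    intro x
    refine cauchySeq_tendsto_of_complete (cauchySeq_of_le_geometric
      (M.lam s / (1 + M.mu p * s)) (D * (x : ℝ) ^ s) (M.contraction_lt_one hs0 hmu) fun n => ?_)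
    rw [dist_comm, Real.dist_eq, Function.iterate_succ_apply]
    refine (M.abs_iterate_avgT_sub_le (M.measurable_avgT _ (measurable_expPow p))
      (measurable_expPow p) (M.abs_avgT_le_one _ (abs_expPow_le_one p))
      (abs_expPow_le_one p) hs0.le hcs (hD 1) n x).trans_eq (by ring)
  choose ψ hψ using key
  exact ⟨ψ, hψ⟩

/-- The limit of the iterates is represented by a probability measure. -/
theorem exists_measure_of_tendsto (hp : 0 < p) (hps : p ≤ s) (hs : s ≤ 2 * p)
    (hmu : M.mu s < M.mu p) {ψ : ℝ≥0 → ℝ}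
    (hψ : ∀ x, Tendsto (fun n => (M.avgT (M.mu p))^[n] (expPow p) x) atTop (𝓝 (ψ x)))
    {q : ℝ} (hq : 0 < q) (R : Measure ℝ≥0) [IsProbabilityMeasure R] {C : ℝ}
    (hR : ∀ x : ℝ≥0, |laplace R ((x : ℝ) ^ q) - expPow p x| ≤ C * (x : ℝ) ^ s) :
    ∃ Q : Measure ℝ≥0, IsProbabilityMeasure Q ∧ (∀ x : ℝ≥0, laplace Q ((x : ℝ) ^ q) = ψ x) ∧
      ∀ (h : ℝ≥0 → ℝ) (b : ℝ≥0∞), Continuous h → 0 ≤ h →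
        (∀ n, ∫⁻ v, ENNReal.ofReal (h v) ∂((M.smooth (M.mu p) q)^[n] R) ≤ b) →
          ∫⁻ v, ENNReal.ofReal (h v) ∂(Q) ≤ b := by
  have hs0 : 0 < s := by linarith
  have hcs := M.neg_one_lt_of_mu_lt hs0 hmu
  obtain ⟨D, hD⟩ := M.exists_abs_iterate_sub_expPow_le hp hps hs hmu
  have hC0 : 0 ≤ C := by simpa using (abs_nonneg _).trans (hR 1)
  have hcmp := M.abs_iterate_avgT_sub_le (measurable_laplace_rpow R hq) (measurable_expPow p)
    (fun x => abs_laplace_le_one R (by positivity)) (abs_expPow_le_one p) hs0.le hcs hR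
  have hpow : ∀ y : ℝ, 0 ≤ y → (((Real.toNNReal y) ^ q⁻¹ : ℝ≥0) : ℝ) ^ q = y := fun y hy => by
    rw [NNReal.coe_rpow, Real.coe_toNNReal y hy, Real.rpow_inv_rpow hy hq.ne']
  -- Tightness bound with y = x^q: the C term compares the two iterations, the D term compares the
  -- iterates with e^{-x^p}, and x^p bounds 1 - e^{-x^p}.
  have hg : ∀ n y, 0 < y → 1 - laplace ((M.smooth (M.mu p) q)^[n] R) y ≤
      (y ^ q⁻¹) ^ p + (C + D) * (y ^ q⁻¹) ^ s := by
    intro n y hy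
    set x : ℝ≥0 := (Real.toNNReal y) ^ q⁻¹ with hx
    have hxy : (x : ℝ) = y ^ q⁻¹ := by rw [hx, NNReal.coe_rpow, Real.coe_toNNReal y hy.le]
    have hyx : y = (x : ℝ) ^ q := (hpow y hy.le).symm
    rw [← hxy]
    nth_rewrite 1 [hyx]
    rw [M.laplace_iterate_smooth (M.mu p) hq]
    have e1 := abs_le.1 (hcmp n x)
    have e2 := abs_le.1 (hD n x)
    have e3 : 1 - (x : ℝ) ^ p ≤ expPow p x := by
      have := Real.add_one_le_exp (-(x : ℝ) ^ p)
      rw [expPow]; linarith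
    have e4 : C * (M.lam s / (1 + M.mu p * s)) ^ n * (x : ℝ) ^ s ≤ C * 1 * (x : ℝ) ^ s := by
      gcongr
      exact pow_le_one₀ (M.contraction_nonneg hcs) (M.contraction_lt_one hs0 hmu).le
    linarith
  have hg0 : Tendsto (fun y : ℝ => (y ^ q⁻¹) ^ p + (C + D) * (y ^ q⁻¹) ^ s) (𝓝[>] 0) (𝓝 0) := by
    have hc : ContinuousAt (fun y : ℝ => (y ^ q⁻¹) ^ p + (C + D) * (y ^ q⁻¹) ^ s) 0 := by
      have hq' : 0 ≤ q⁻¹ := by positivity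
      have hb : ContinuousAt (fun y : ℝ => y ^ q⁻¹) 0 := continuousAt_id.rpow_const (Or.inr hq')
      exact (hb.rpow_const (Or.inr hp.le)).add
        (continuousAt_const.mul (hb.rpow_const (Or.inr hs0.le)))
    have h0 := hc.tendsto.mono_left (nhdsWithin_le_nhds (s := Set.Ioi 0))
    simp only [Real.zero_rpow (inv_ne_zero hq.ne'), Real.zero_rpow hp.ne',
      Real.zero_rpow hs0.ne', mul_zero, add_zero] at h0
    exact h0
  have hf : ∀ y, 0 ≤ y → Tendsto (fun n => laplace ((M.smooth (M.mu p) q)^[n] R) y) atTop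
      (𝓝 (ψ ((Real.toNNReal y) ^ q⁻¹))) := by
    intro y hy
    set x : ℝ≥0 := (Real.toNNReal y) ^ q⁻¹ with hx
    have hyx : y = (x : ℝ) ^ q := (hpow y hy).symm
    rw [hyx]
    simp_rw [M.laplace_iterate_smooth (M.mu p) hq]
    have e := squeeze_zero_norm (f := fun n => (M.avgT (M.mu p))^[n]
      (fun x => laplace R ((x : ℝ) ^ q)) x - (M.avgT (M.mu p))^[n] (expPow p) x)
      (fun n => hcmp n x) (M.tendsto_contraction hs0 hmu C _)
    simpa using e.add (hψ x)
  obtain ⟨Q, hQ, h1, h2⟩ := exists_laplace_limit hg hg0 hf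
  refine ⟨Q, hQ, fun x => ?_, h2⟩
  rw [h1 _ (by positivity)]
  congr 1
  rw [← NNReal.coe_inj, NNReal.coe_rpow, Real.coe_toNNReal _ (by positivity),
    Real.rpow_rpow_inv (by positivity) hq.ne']

/-- The limit of the iterates is a self-similar profile. -/
theorem isProfile_of_tendsto (hp : 0 < p) (hps : p < s) (hs : s ≤ 2 * p)
    (hmu : M.mu s < M.mu p) {ψ : ℝ≥0 → ℝ}
    (hψ : ∀ x, Tendsto (fun n => (M.avgT (M.mu p))^[n] (expPow p) x) atTop (𝓝 (ψ x))) :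
    M.IsProfile p ψ := by
  have hs0 : 0 < s := by linarith
  have hcs := M.neg_one_lt_of_mu_lt hs0 hmu
  obtain ⟨D, hD⟩ := M.exists_abs_iterate_sub_expPow_le hp hps.le hs hmu
  obtain ⟨Q, hQ, hQψ, -⟩ := M.exists_measure_of_tendsto hp hps.le hs hmu hψ hp (Measure.dirac 1)
    (C := 0) (fun x => by simp [laplace_dirac_one, expPow])
  have hcont : Continuous ψ := by
    rw [← funext hQψ]
    exact continuous_laplace_comp Q (g := fun x : ℝ≥0 => (x : ℝ) ^ p)
      (NNReal.continuous_coe.rpow_const fun _ => Or.inr hp.le) fun x => by positivity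
  have hle : ∀ x, |ψ x| ≤ 1 := fun x => by
    rw [← hQψ]; exact abs_laplace_le_one Q (by positivity)
  refine ⟨hcont, hle, fun x => ?_, s - p, by linarith, D + 1, fun x => ?_⟩
  -- The iterates n + m and n are compared and m → ∞; this rate passes the limit through the
  -- operator.
  · have h1 : ∀ n (x : ℝ≥0), |ψ x - (M.avgT (M.mu p))^[n] (expPow p) x| ≤
        D * (M.lam s / (1 + M.mu p * s)) ^ n * (x : ℝ) ^ s := by
      intro n x
      refine le_of_tendsto (((hψ x).comp (tendsto_add_atTop_nat n)).sub_const
        ((M.avgT (M.mu p))^[n] (expPow p) x)).abs (Eventually.of_forall fun m => ?_)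
      simp only [Function.comp_apply]
      rw [add_comm m n, Function.iterate_add_apply]
      exact M.abs_iterate_avgT_sub_le (M.measurable_iterate_avgT _ (measurable_expPow p) m)
        (measurable_expPow p) (M.abs_iterate_avgT_le_one _ (abs_expPow_le_one p) m)
        (abs_expPow_le_one p) hs0.le hcs (hD m) n x
    have h2 : Tendsto (fun n => (M.avgT (M.mu p))^[n + 1] (expPow p) x) atTop
        (𝓝 (M.avgT (M.mu p) ψ x)) := by
      rw [tendsto_iff_norm_sub_tendsto_zero]
      have hlim := (M.tendsto_contraction hs0 hmu D
        (M.lam s / (1 + M.mu p * s) * (x : ℝ) ^ s))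
      refine squeeze_zero (fun n => norm_nonneg _) (fun n => ?_) hlim
      rw [norm_sub_rev, Real.norm_eq_abs, Function.iterate_succ_apply']
      refine (M.abs_avgT_sub_le hcont.measurable
        (M.measurable_iterate_avgT _ (measurable_expPow p) n) hle
        (M.abs_iterate_avgT_le_one _ (abs_expPow_le_one p) n) hs0.le hcs (h1 n) x).trans_eq ?_
      ring
    exact tendsto_nhds_unique ((hψ x).comp (tendsto_add_atTop_nat 1)) h2
  · have h1 : |ψ x - expPow p x| ≤ D * (x : ℝ) ^ s :=
      le_of_tendsto ((hψ x).sub_const _).abs (Eventually.of_forall fun n => hD n x)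
    rw [add_sub_cancel, add_mul, one_mul]
    exact (abs_sub_le _ (expPow p x) _).trans
      (add_le_add h1 (abs_expPow_sub_le hp hps.le hs x))

/-- Every self-similar profile is the limit of the iterates. -/
theorem IsProfile.tendsto_iterate {M : MaxwellModel N} (hp : 0 < p) (hps : p < s) (hs : s ≤ 2 * p)
    (hmu : ∀ t, p < t → t ≤ s → M.mu t < M.mu p) {ψ : ℝ≥0 → ℝ} (h : M.IsProfile p ψ) (x : ℝ≥0) :
    Tendsto (fun n => (M.avgT (M.mu p))^[n] (expPow p) x) atTop (𝓝 (ψ x)) := by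
  obtain ⟨ε, hε, C, hC⟩ := h.asymptotics
  -- The ε of a given profile may be small, so the exponent is lowered; contraction holds on all of
  -- (p, s].
  set t := min s (p + ε) with ht
  have htp : p < t := lt_min hps (by linarith)
  have hts : t ≤ s := min_le_left _ _
  have ht0 : 0 < t := by linarith
  have hfix : ∀ n, (M.avgT (M.mu p))^[n] ψ = ψ := fun n =>
    Function.iterate_fixed (funext fun x => (h.equation x).symm) n
  -- The part 1 + C comes from the two expansions for x ≤ 1, the part 2 from the trivial bound for x
  -- ≥ 1.
  have h1 : ∀ x : ℝ≥0, |expPow p x - ψ x| ≤ (1 + C + 2) * (x : ℝ) ^ t := by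
    intro x
    have hb : |expPow p x - ψ x| ≤ 2 := by
      have := abs_sub (expPow p x) (ψ x)
      have := abs_expPow_le_one p x
      have := h.abs_le_one x
      linarith
    have hC0 : 0 ≤ C := by simpa using (abs_nonneg _).trans (hC 1)
    rcases le_total (x : ℝ) 1 with hx | hx
    · have h3 : (x : ℝ) ^ (p + ε) ≤ (x : ℝ) ^ t := by
        rcases x.coe_nonneg.eq_or_lt with h0 | h0
        · rw [← h0, Real.zero_rpow (by linarith), Real.zero_rpow ht0.ne']
        · exact Real.rpow_le_rpow_of_exponent_ge h0 hx (min_le_right _ _)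
      have h4 := abs_expPow_sub_le hp htp.le (hts.trans hs) x
      have h5 := (hC x).trans (mul_le_mul_of_nonneg_left h3 hC0)
      rw [abs_sub_comm] at h5
      have h6 := abs_sub_le (expPow p x) (1 - (x : ℝ) ^ p) (ψ x)
      have h7 : 0 ≤ (x : ℝ) ^ t := by positivity
      linarith
    · have h3 : 1 ≤ (x : ℝ) ^ t := Real.one_le_rpow hx ht0.le
      nlinarith
  have hmt := hmu t htp hts
  have h2 := fun n => M.abs_iterate_avgT_sub_le (measurable_expPow p) h.continuous.measurable
    (abs_expPow_le_one p) h.abs_le_one ht0.le (M.neg_one_lt_of_mu_lt ht0 hmt) h1 n x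
  simp_rw [hfix] at h2
  rw [tendsto_iff_norm_sub_tendsto_zero]
  exact squeeze_zero (fun n => norm_nonneg _) h2 (M.tendsto_contraction ht0 hmt _ _)

end Limit

end MaxwellModel

/-! ### A law on the half-line with expansion 1 - x^p + O(x). -/

/-- The constant `∫₀^∞ (1 - e^{-v}) v^{-s-1} dv`. -/
noncomputable def levyInt (s : ℝ) : ℝ := ∫ v in Set.Ioi (0 : ℝ), (1 - Real.exp (-v)) * v ^ (-s - 1)

lemma one_sub_exp_nonneg {y : ℝ} (hy : 0 ≤ y) : 0 ≤ 1 - Real.exp (-y) := by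
  have : Real.exp (-y) ≤ 1 := by rw [Real.exp_le_one_iff]; linarith
  linarith

lemma one_sub_exp_le (y : ℝ) : 1 - Real.exp (-y) ≤ y := by
  have := Real.add_one_le_exp (-y); linarith

lemma one_sub_exp_mul_rpow_le {x v s : ℝ} (hv : 0 < v) :
    (1 - Real.exp (-(x * v))) * v ^ (-s - 1) ≤ x * v ^ (-s) := by
  calc (1 - Real.exp (-(x * v))) * v ^ (-s - 1) ≤ (x * v) * v ^ (-s - 1) := by
        gcongr; exact one_sub_exp_le _
    _ = x * v ^ (-s) := by rw [mul_assoc, Real.rpow_sub_one hv.ne']; field_simp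

lemma integrableOn_levy {s x : ℝ} (hs0 : 0 < s) (hs1 : s < 1) (hx : 0 ≤ x) :
    IntegrableOn (fun v : ℝ => (1 - Real.exp (-(x * v))) * v ^ (-s - 1)) (Set.Ioi 0) := by
  rw [← Set.Ioc_union_Ioi_eq_Ioi (zero_le_one (α := ℝ)), integrableOn_union]
  have hm : Measurable fun v : ℝ => (1 - Real.exp (-(x * v))) * v ^ (-s - 1) := by fun_prop
  constructor
  · refine Integrable.mono' ((integrableOn_rpow_Ioc (r := -s) (by linarith)).const_mul x)
      hm.aestronglyMeasurable (ae_restrict_of_forall_mem measurableSet_Ioc fun v hv => ?_)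
    have hv0 := hv.1
    rw [Real.norm_eq_abs, abs_of_nonneg
      (mul_nonneg (one_sub_exp_nonneg (by positivity)) (by positivity))]
    exact one_sub_exp_mul_rpow_le hv0
  · refine Integrable.mono' (integrableOn_Ioi_rpow_of_lt (a := -s - 1) (by linarith) zero_lt_one)
      hm.aestronglyMeasurable (ae_restrict_of_forall_mem measurableSet_Ioi fun v hv => ?_)
    have hv0 : 0 < v := lt_trans zero_lt_one hv
    rw [Real.norm_eq_abs, abs_of_nonneg
      (mul_nonneg (one_sub_exp_nonneg (by positivity)) (by positivity))]
    have := Real.exp_pos (-(x * v))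
    exact mul_le_of_le_one_left (by positivity) (by linarith)

lemma integral_levy {s x : ℝ} (hs : s ≠ 0) (hx : 0 ≤ x) :
    ∫ v in Set.Ioi (0 : ℝ), (1 - Real.exp (-(x * v))) * v ^ (-s - 1) = x ^ s * levyInt s := by
  rcases hx.eq_or_lt with rfl | hx
  · simp [Real.zero_rpow hs]
  have h := integral_comp_mul_left_Ioi
    (fun v : ℝ => (1 - Real.exp (-v)) * v ^ (-s - 1)) 0 hx
  rw [mul_zero, smul_eq_mul] at h
  rw [levyInt]
  have h2 : ∀ v ∈ Set.Ioi (0 : ℝ), (1 - Real.exp (-(x * v))) * v ^ (-s - 1) =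
      x ^ (s + 1) * ((1 - Real.exp (-(x * v))) * (x * v) ^ (-s - 1)) := by
    intro v hv
    have hv0 : (0 : ℝ) < v := hv
    rw [Real.mul_rpow hx.le hv0.le]
    have : x ^ (s + 1) * x ^ (-s - 1) = 1 := by
      rw [← Real.rpow_add hx]; simp
    linear_combination (-(1 - Real.exp (-(x * v))) * v ^ (-s - 1)) * this
  rw [setIntegral_congr_fun measurableSet_Ioi h2, integral_const_mul, h,
    Real.rpow_add_one hx.ne']
  field_simp

lemma levyInt_pos {s : ℝ} (hs0 : 0 < s) (hs1 : s < 1) : 0 < levyInt s := by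
  have hi := integrableOn_levy hs0 hs1 zero_le_one
  simp_rw [one_mul] at hi
  have hpos : ∀ v ∈ Set.Ioi (0 : ℝ), 0 < (1 - Real.exp (-v)) * v ^ (-s - 1) := fun v hv => by
    have hv0 : (0 : ℝ) < v := hv
    have : Real.exp (-v) < 1 := by rw [Real.exp_lt_one_iff]; linarith
    exact mul_pos (by linarith) (by positivity)
  rw [levyInt, setIntegral_pos_iff_support_of_nonneg_ae
    (ae_restrict_of_forall_mem measurableSet_Ioi fun v hv => (hpos v hv).le) hi]
  have : Set.Ioi (0 : ℝ) ⊆ (Function.support fun v : ℝ => (1 - Real.exp (-v)) * v ^ (-s - 1)) ∩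
      Set.Ioi 0 := fun v hv => ⟨(hpos v hv).ne', hv⟩
  exact lt_of_lt_of_le (by simp) (measure_mono this)

open ProbabilityTheory in
lemma integral_paretoMeasure {t p : ℝ} (ht : 0 < t) (hp : 0 < p) (f : ℝ → ℝ) :
    ∫ v, f v ∂(paretoMeasure t p) = ∫ v in Set.Ioi t, f v * (p * t ^ p * v ^ (-p - 1)) := by
  rw [paretoMeasure]
  unfold paretoPDF
  rw [integral_withDensity_eq_integral_toReal_smul (by fun_prop) (by simp),
    ← integral_Ici_eq_integral_Ioi, ← integral_indicator measurableSet_Ici]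
  refine integral_congr_ae (ae_of_all _ fun v => ?_)
  dsimp only
  rw [ENNReal.toReal_ofReal (paretoPDFReal_nonneg ht.le hp.le v), smul_eq_mul, Set.indicator_apply,
    paretoPDFReal]
  simp only [Set.mem_Ici]
  split_ifs with h
  · rw [mul_comm, neg_add']
  · simp

open ProbabilityTheory in
/-- A probability measure whose Laplace transform is `1 - x^p + O(x)` at `0`. -/
theorem exists_laplace_sub_le {p : ℝ} (hp0 : 0 < p) (hp1 : p < 1) :
    ∃ (P : Measure ℝ≥0) (C : ℝ), IsProbabilityMeasure P ∧
      ∀ x : ℝ, 0 ≤ x → |laplace P x - (1 - x ^ p)| ≤ C * x := by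
  have hc := levyInt_pos hp0 hp1
  -- The cut-off t normalizes the coefficient of x^p to one.
  set t : ℝ := ((p * levyInt p)⁻¹) ^ p⁻¹ with htd
  have ht : 0 < t := by positivity
  have htp : p * t ^ p * levyInt p = 1 := by
    rw [htd, Real.rpow_inv_rpow (by positivity) hp0.ne']
    field_simp
  have := isProbabilityMeasure_paretoMeasure ht hp0
  have hpm : IsProbabilityMeasure ((paretoMeasure t p).map Real.toNNReal) :=
    Measure.isProbabilityMeasure_map (by fun_prop)
  refine ⟨(paretoMeasure t p).map Real.toNNReal,
    p * t ^ p * ∫ v in Set.Ioc (0 : ℝ) t, v ^ (-p), hpm, fun x hx => ?_⟩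
  have hint := integrableOn_levy hp0 hp1 hx
  have h1 : 1 - laplace ((paretoMeasure t p).map Real.toNNReal) x =
      p * t ^ p * ∫ v in Set.Ioi t, (1 - Real.exp (-(x * v))) * v ^ (-p - 1) := by
    have e1 : 1 - laplace ((paretoMeasure t p).map Real.toNNReal) x =
        ∫ v : ℝ≥0, (1 - Real.exp (-((v : ℝ) * x))) ∂((paretoMeasure t p).map Real.toNNReal) := by
      rw [integral_sub (integrable_const _) (integrable_exp_neg_mul _ hx)]
      simp [laplace]
    rw [e1, integral_map (by fun_prop) (Measurable.aestronglyMeasurable (by fun_prop)),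
      integral_paretoMeasure ht hp0, ← integral_const_mul]
    refine setIntegral_congr_fun measurableSet_Ioi fun v hv => ?_
    have hv0 : 0 < v := lt_trans ht hv
    rw [Real.coe_toNNReal v hv0.le, mul_comm v x]
    ring
  -- The integral over the whole half-line is exactly homogeneous of degree p; the missing piece on
  -- (0, t] is the O(x) error.
  have hdec : (∫ v in Set.Ioc 0 t, (1 - Real.exp (-(x * v))) * v ^ (-p - 1)) +
      ∫ v in Set.Ioi t, (1 - Real.exp (-(x * v))) * v ^ (-p - 1) = x ^ p * levyInt p := by
    rw [← integral_levy hp0.ne' hx, ← Set.Ioc_union_Ioi_eq_Ioi ht.le]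
    refine (setIntegral_union (Set.Ioc_disjoint_Ioi le_rfl) measurableSet_Ioi
      (hint.mono_set Set.Ioc_subset_Ioi_self) (hint.mono_set ?_)).symm
    exact Set.Ioi_subset_Ioi ht.le
  have h0 : 0 ≤ ∫ v in Set.Ioc 0 t, (1 - Real.exp (-(x * v))) * v ^ (-p - 1) :=
    setIntegral_nonneg measurableSet_Ioc fun v hv => by
      have hv0 := hv.1
      exact mul_nonneg (one_sub_exp_nonneg (by positivity)) (by positivity)
  have hti : IntegrableOn (fun v : ℝ => v ^ (-p)) (Set.Ioc 0 t) := by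
    have := intervalIntegral.intervalIntegrable_rpow' (a := 0) (b := t) (r := -p) (by linarith)
    rwa [intervalIntegrable_iff_integrableOn_Ioc_of_le ht.le] at this
  have h2 : ∫ v in Set.Ioc 0 t, (1 - Real.exp (-(x * v))) * v ^ (-p - 1) ≤
      x * ∫ v in Set.Ioc (0 : ℝ) t, v ^ (-p) := by
    rw [← integral_const_mul]
    exact setIntegral_mono_on (hint.mono_set Set.Ioc_subset_Ioi_self) (hti.const_mul x)
      measurableSet_Ioc fun v hv => one_sub_exp_mul_rpow_le hv.1
  have h3 : laplace ((paretoMeasure t p).map Real.toNNReal) x - (1 - x ^ p) =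
      p * t ^ p * ∫ v in Set.Ioc 0 t, (1 - Real.exp (-(x * v))) * v ^ (-p - 1) := by
    linear_combination (-1 : ℝ) * h1 - (p * t ^ p) * hdec - x ^ p * htp
  rw [h3, abs_of_nonneg (by positivity)]
  calc _ ≤ p * t ^ p * (x * ∫ v in Set.Ioc (0 : ℝ) t, v ^ (-p)) := by gcongr
    _ = _ := by ring

/-! ### Existence of the profile with its mixing and Laplace measures. -/

namespace MaxwellModel

variable {N : ℕ}

/-- The exponent range in which the averaged operator is a contraction. -/
lemma exists_exponent (M : MaxwellModel N) {p : ℝ} (hp : 0 < p)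
    (hpc : ENNReal.ofReal p < M.critExp) : ∃ s, p < s ∧ s ≤ 2 * p ∧ (p < 1 → s ≤ 1) ∧
      ∀ t, p < t → t ≤ s → M.mu t < M.mu p := by
  obtain ⟨r, hr, hanti⟩ := M.exists_strictAntiOn_of_lt_critExp hpc
  have h2 : p < 2 * p := by linarith
  by_cases h1 : p < 1
  · refine ⟨min r (min (2 * p) 1), lt_min hr (lt_min h2 h1), ?_, ?_, fun t hpt hts => ?_⟩
    · exact (min_le_right _ _).trans (min_le_left _ _)
    · exact fun _ => (min_le_right _ _).trans (min_le_right _ _)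
    · exact hanti ⟨hp, hr.le⟩ ⟨hp.trans hpt, hts.trans (min_le_left _ _)⟩ hpt
  · refine ⟨min r (2 * p), lt_min hr h2, min_le_right _ _, fun h => absurd h h1,
      fun t hpt hts => ?_⟩
    exact hanti ⟨hp, hr.le⟩ ⟨hp.trans hpt, hts.trans (min_le_left _ _)⟩ hpt

/-- One limit ψ is represented twice, by iterating the smoothing transform with q = p and with q =
1. The starting law for q = 1 needs to match e^{-x^p} only up to O(x^s), since the contraction
removes the difference. -/
theorem exists_profile_laplace (M : MaxwellModel N) {p : ℝ} (hp : 0 < p) (hp1 : p ≤ 1)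
    (hpc : ENNReal.ofReal p < M.critExp) : ∃ (ψ : ℝ≥0 → ℝ) (R Φ : Measure ℝ≥0),
      M.IsProfile p ψ ∧ IsMixingMeasure p ψ R ∧ IsLaplaceDistribution ψ Φ := by
  obtain ⟨s, hps, hs2, hs1, hmu⟩ := M.exists_exponent hp hpc
  have hms := hmu s hps le_rfl
  obtain ⟨ψ, hψ⟩ := M.tendsto_iterate_expPow hp hps.le hs2 hms
  obtain ⟨R, hR, hRψ, -⟩ := M.exists_measure_of_tendsto hp hps.le hs2 hms hψ hp (Measure.dirac 1)
    (C := 0) (fun x => by simp [laplace_dirac_one, expPow])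
  obtain ⟨Φ, hΦ, hΦψ⟩ : ∃ Φ : Measure ℝ≥0, IsProbabilityMeasure Φ ∧
      ∀ x : ℝ≥0, laplace Φ ((x : ℝ) ^ (1 : ℝ)) = ψ x := by
    rcases hp1.eq_or_lt with rfl | hp1
    · exact ⟨R, hR, hRψ⟩
    obtain ⟨P, C, hP, hPC⟩ := exists_laplace_sub_le hp hp1
    -- Near 0 the bound s ≤ 1 turns O(x) into O(x^s); for x ≥ 1 the trivial bound 2 is enough.
    have h1 : ∀ x : ℝ≥0, |laplace P ((x : ℝ) ^ (1 : ℝ)) - expPow p x| ≤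
        max C 2 * (x : ℝ) ^ s + (x : ℝ) ^ s := by
      intro x
      rw [Real.rpow_one]
      rcases le_total (x : ℝ) 1 with hx | hx
      · have h3 : (x : ℝ) ≤ (x : ℝ) ^ s := by
          rcases x.coe_nonneg.eq_or_lt with h0 | h0
          · rw [← h0, Real.zero_rpow (by linarith)]
          · simpa using Real.rpow_le_rpow_of_exponent_ge h0 hx (hs1 hp1)
        have hC0 : 0 ≤ C := by simpa using (abs_nonneg _).trans (hPC 1 zero_le_one)
        have h4 := abs_expPow_sub_le hp hps.le hs2 x
        rw [abs_sub_comm] at h4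
        have h5 := (hPC x x.coe_nonneg).trans (mul_le_mul_of_nonneg_left h3 hC0)
        have h6 : C * (x : ℝ) ^ s ≤ max C 2 * (x : ℝ) ^ s := by gcongr; exact le_max_left _ _
        have := abs_sub_le (laplace P x) (1 - (x : ℝ) ^ p) (expPow p x)
        linarith
      · have h3 : 1 ≤ (x : ℝ) ^ s := Real.one_le_rpow hx (by linarith)
        have h4 : 2 * 1 ≤ max C 2 * (x : ℝ) ^ s := by gcongr; exact le_max_right _ _
        have := abs_sub (laplace P x) (expPow p x)
        have := abs_expPow_le_one p x
        have := abs_laplace_le_one P x.coe_nonneg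
        linarith
    obtain ⟨Φ, hΦ, hΦψ, -⟩ := M.exists_measure_of_tendsto hp hps.le hs2 hms hψ one_pos P
      (C := max C 2 + 1) (fun x => (h1 x).trans_eq (by ring))
    exact ⟨Φ, hΦ, hΦψ⟩
  refine ⟨ψ, R, Φ, M.isProfile_of_tendsto hp hps hs2 hms hψ, ⟨hR, hRψ⟩, ⟨hΦ, fun x => ?_⟩⟩
  rw [← hΦψ x, Real.rpow_one, laplace]
  simp_rw [mul_comm]

end MaxwellModel

/-! ### Gaussian mixtures: passing from Φ to F. -/

open ProbabilityTheory in
/-- The law of `√(2V) G`, where `V` has law `Φ` and `G` is a standard Gaussian vector. -/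
noncomputable def gaussMix (d : ℕ) (Φ : Measure ℝ≥0) : Measure (EuclideanSpace ℝ (Fin d)) :=
  (Φ.prod (stdGaussian (EuclideanSpace ℝ (Fin d)))).map
    (fun z => Real.sqrt (2 * (z.1 : ℝ)) • z.2)

lemma measurable_gaussMix_map (d : ℕ) : Measurable
    (fun z : ℝ≥0 × EuclideanSpace ℝ (Fin d) => Real.sqrt (2 * (z.1 : ℝ)) • z.2) := by
  fun_prop

open ProbabilityTheory in
instance (d : ℕ) (Φ : Measure ℝ≥0) [IsProbabilityMeasure Φ] :
    IsProbabilityMeasure (gaussMix d Φ) :=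
  Measure.isProbabilityMeasure_map (measurable_gaussMix_map d).aemeasurable

open ProbabilityTheory in
lemma charFun_gaussMix (d : ℕ) (Φ : Measure ℝ≥0) [IsProbabilityMeasure Φ]
    (k : EuclideanSpace ℝ (Fin d)) :
    charFun (gaussMix d Φ) k = ((laplace Φ (‖k‖ ^ 2) : ℝ) : ℂ) := by
  rw [gaussMix, charFun_apply, integral_map (measurable_gaussMix_map d).aemeasurable
    (Measurable.aestronglyMeasurable (by fun_prop)), integral_prod, laplace,
    ← integral_complex_ofReal]
  · refine integral_congr_ae (ae_of_all _ fun v => ?_)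
    -- For fixed V = v, the scaled Gaussian has characteristic function e^{-v|k|²}.
    have h := charFun_stdGaussian (Real.sqrt (2 * (v : ℝ)) • k)
    rw [charFun_apply] at h
    dsimp only
    simp_rw [real_inner_smul_left, ← real_inner_smul_right]
    rw [h, norm_smul, Real.norm_eq_abs, ← Complex.ofReal_pow, mul_pow, sq_abs, Real.sq_sqrt (by positivity)]
    push_cast
    congr 1
    ring
  · refine Integrable.of_bound (C := 1) (Measurable.aestronglyMeasurable (by fun_prop))
      (ae_of_all _ fun z => ?_)
    rw [Complex.norm_exp_ofReal_mul_I]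

lemma IsLaplaceDistribution.laplace_eq {ψ : ℝ≥0 → ℝ} {Φ : Measure ℝ≥0}
    (h : IsLaplaceDistribution ψ Φ) (x : ℝ≥0) : laplace Φ x = ψ x := by
  rw [← h.2 x, laplace]
  simp_rw [mul_comm]

lemma isFourierDistribution_gaussMix (d : ℕ) {ψ : ℝ≥0 → ℝ} {Φ : Measure ℝ≥0}
    (h : IsLaplaceDistribution ψ Φ) : IsFourierDistribution ψ (gaussMix d Φ) := by
  have := h.1
  refine ⟨inferInstance, fun k => ?_⟩
  rw [charFun_gaussMix, ← h.laplace_eq]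
  simp

/-- Uniqueness of characteristic functions. Consequently an arbitrary F has the explicit mixture
form on which moments can be computed. -/
lemma IsFourierDistribution.eq_gaussMix {d : ℕ} {ψ : ℝ≥0 → ℝ} {Φ : Measure ℝ≥0}
    {F : Measure (EuclideanSpace ℝ (Fin d))} (hF : IsFourierDistribution ψ F)
    (h : IsLaplaceDistribution ψ Φ) : F = gaussMix d Φ := by
  have := hF.1
  have hG := isFourierDistribution_gaussMix d h
  have := hG.1
  exact Measure.ext_of_charFun (funext fun k => by rw [hF.2, hG.2])

open ProbabilityTheory in
lemma lintegral_stdGaussian_norm_rpow {d : ℕ} (hd : 0 < d) {s : ℝ} (hs : 0 < s) :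
    ∫⁻ g, ENNReal.ofReal (‖g‖ ^ s) ∂(stdGaussian (EuclideanSpace ℝ (Fin d))) ≠ 0 ∧
    ∫⁻ g, ENNReal.ofReal (‖g‖ ^ s) ∂(stdGaussian (EuclideanSpace ℝ (Fin d))) < ∞ := by
  constructor
  · intro h0
    rw [lintegral_eq_zero_iff (by fun_prop)] at h0
    have h1 : ∀ᵐ g ∂(stdGaussian (EuclideanSpace ℝ (Fin d))), g = 0 := by
      filter_upwards [h0] with g hg
      simp only [Pi.zero_apply, ENNReal.ofReal_eq_zero] at hg
      by_contra hne
      have : 0 < ‖g‖ := norm_pos_iff.2 hne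
      have : 0 < ‖g‖ ^ s := by positivity
      linarith
    -- If the moment vanished, the Gaussian would be concentrated at 0 and its characteristic
    -- function would be 1 at a unit vector, which exists because d > 0.
    let k : EuclideanSpace ℝ (Fin d) := EuclideanSpace.single ⟨0, hd⟩ 1
    have h2 := charFun_stdGaussian k
    have h3 : charFun (stdGaussian (EuclideanSpace ℝ (Fin d))) k = 1 := by
      rw [charFun_apply, integral_congr_ae (g := fun _ => (1 : ℂ))]
      · simp
      · filter_upwards [h1] with g hg
        simp [hg]
    rw [h3] at h2
    have hk : ‖k‖ = 1 := by simp [k]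
    rw [hk] at h2
    have h4 : (1 : ℝ) = Real.exp (-1 / 2) := by
      have := congrArg Complex.re h2
      rw [show (-((1 : ℝ) : ℂ) ^ 2 / 2) = ((-1 / 2 : ℝ) : ℂ) by push_cast; ring,
        Complex.exp_ofReal_re] at this
      simpa using this
    have : Real.exp (-1 / 2) < 1 := by rw [Real.exp_lt_one_iff]; norm_num
    linarith
  · have h := (IsGaussian.memLp_id (stdGaussian (EuclideanSpace ℝ (Fin d)))
      (ENNReal.ofReal s) ENNReal.ofReal_ne_top)
    have h1 := h.integrable_norm_rpow (by simpa using hs) ENNReal.ofReal_ne_top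
    rw [ENNReal.toReal_ofReal hs.le] at h1
    have h2 := h1.2
    rw [hasFiniteIntegral_iff_ofReal (ae_of_all _ fun v => by positivity)] at h2
    simpa using h2

open ProbabilityTheory in
lemma fourierMoment_gaussMix (d : ℕ) (Φ : Measure ℝ≥0) [IsProbabilityMeasure Φ] (s : ℝ) :
    fourierMoment (gaussMix d Φ) s = ENNReal.ofReal (2 ^ s) * laplaceMoment Φ s *
      ∫⁻ g, ENNReal.ofReal (‖g‖ ^ (2 * s)) ∂(stdGaussian (EuclideanSpace ℝ (Fin d))) := by
  set G := ∫⁻ g, ENNReal.ofReal (‖g‖ ^ (2 * s)) ∂(stdGaussian (EuclideanSpace ℝ (Fin d))) with hG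
  have h : fourierMoment (gaussMix d Φ) s =
      ∫⁻ v : ℝ≥0, ENNReal.ofReal (2 ^ s) * ENNReal.ofReal ((v : ℝ) ^ s) * G ∂Φ := by
    rw [fourierMoment, gaussMix, lintegral_map (by fun_prop) (measurable_gaussMix_map d),
      lintegral_prod _ (by fun_prop)]
    refine lintegral_congr fun v => ?_
    rw [hG, ← lintegral_const_mul _ (by fun_prop)]
    refine lintegral_congr fun g => ?_
    rw [norm_smul, Real.norm_eq_abs, abs_of_nonneg (Real.sqrt_nonneg _),
      Real.mul_rpow (Real.sqrt_nonneg _) (norm_nonneg _), Real.rpow_mul (Real.sqrt_nonneg _),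
      Real.rpow_two, Real.sq_sqrt (by positivity), Real.mul_rpow (by norm_num) (by positivity),
      ENNReal.ofReal_mul (by positivity), ENNReal.ofReal_mul (by positivity)]
  rw [h, lintegral_mul_const _ (by fun_prop), lintegral_const_mul _ (by fun_prop), laplaceMoment]

/-- The moments of `F` and of `Φ` are finite for the same exponents. -/
theorem IsFourierDistribution.fourierMoment_lt_top_iff {d : ℕ} (hd : 0 < d) {ψ : ℝ≥0 → ℝ}
    {Φ : Measure ℝ≥0} {F : Measure (EuclideanSpace ℝ (Fin d))} (hF : IsFourierDistribution ψ F)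
    (h : IsLaplaceDistribution ψ Φ) {s : ℝ} (hs : 0 < s) :
    fourierMoment F s < ∞ ↔ laplaceMoment Φ s < ∞ := by
  have := h.1
  obtain ⟨h0, h1⟩ := lintegral_stdGaussian_norm_rpow hd (s := 2 * s) (by linarith)
  rw [hF.eq_gaussMix h, fourierMoment_gaussMix]
  constructor
  · intro hlt
    by_contra htop
    rw [not_lt, top_le_iff] at htop
    rw [htop, ENNReal.mul_top (by simp only [ne_eq, ENNReal.ofReal_eq_zero, not_le]; positivity),
      ENNReal.top_mul h0] at hlt
    exact lt_irrefl _ hlt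
  · exact fun hlt => ENNReal.mul_lt_top (ENNReal.mul_lt_top ENNReal.ofReal_lt_top hlt) h1

/-! ### Fractional moments for p < 1. -/

lemma lintegral_levy {s v : ℝ} (hs0 : 0 < s) (hs1 : s < 1) (hv : 0 ≤ v) :
    ∫⁻ x in Set.Ioi (0 : ℝ), ENNReal.ofReal ((1 - Real.exp (-(v * x))) * x ^ (-s - 1)) =
      ENNReal.ofReal (v ^ s) * ENNReal.ofReal (levyInt s) := by
  rw [← ENNReal.ofReal_mul (by positivity), ← integral_levy hs0.ne' hv,
    ofReal_integral_eq_lintegral_ofReal (integrableOn_levy hs0 hs1 hv)]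
  exact ae_restrict_of_forall_mem measurableSet_Ioi fun x hx => by
    have hx0 : (0 : ℝ) < x := hx
    exact mul_nonneg (one_sub_exp_nonneg (by positivity)) (by positivity)

/-- Fractional moments in terms of the Laplace transform. -/
lemma laplaceMoment_mul_levyInt (Φ : Measure ℝ≥0) [IsProbabilityMeasure Φ] {s : ℝ} (hs0 : 0 < s)
    (hs1 : s < 1) : laplaceMoment Φ s * ENNReal.ofReal (levyInt s) =
      ∫⁻ x in Set.Ioi (0 : ℝ), ENNReal.ofReal ((1 - laplace Φ x) * x ^ (-s - 1)) := by
  rw [laplaceMoment, ← lintegral_mul_const _ (by fun_prop)]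
  simp_rw [← lintegral_levy hs0 hs1 (NNReal.coe_nonneg _)]
  rw [lintegral_lintegral_swap (by fun_prop)]
  refine setLIntegral_congr_fun measurableSet_Ioi fun x hx => ?_
  have hx0 : (0 : ℝ) < x := hx
  have h1 : 1 - laplace Φ x = ∫ v : ℝ≥0, (1 - Real.exp (-((v : ℝ) * x))) ∂Φ := by
    rw [integral_sub (integrable_const _) (integrable_exp_neg_mul _ hx0.le)]
    simp [laplace]
  have hi : Integrable (fun v : ℝ≥0 => 1 - Real.exp (-((v : ℝ) * x))) Φ :=
    (integrable_const _).sub (integrable_exp_neg_mul _ hx0.le)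
  rw [h1, ← integral_mul_const, ofReal_integral_eq_lintegral_ofReal (hi.mul_const _)]
  exact ae_of_all _ fun v => mul_nonneg (one_sub_exp_nonneg (by positivity)) (by positivity)

lemma laplaceMoment_le_one_add (Φ : Measure ℝ≥0) [IsProbabilityMeasure Φ] {s t : ℝ}
    (hs : 0 ≤ s) (hst : s ≤ t) : laplaceMoment Φ s ≤ 1 + laplaceMoment Φ t := by
  have : laplaceMoment Φ s ≤ ∫⁻ v : ℝ≥0, (1 + ENNReal.ofReal ((v : ℝ) ^ t)) ∂Φ := by
    refine lintegral_mono fun v => ?_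
    rw [← ENNReal.ofReal_one, ← ENNReal.ofReal_add zero_le_one (by positivity)]
    refine ENNReal.ofReal_le_ofReal ?_
    rcases le_total (v : ℝ) 1 with hv | hv
    · have := Real.rpow_le_one v.coe_nonneg hv hs
      have : 0 ≤ (v : ℝ) ^ t := by positivity
      linarith
    · have := Real.rpow_le_rpow_of_exponent_le hv hst
      linarith
  rw [lintegral_add_left (by fun_prop)] at this
  simpa [laplaceMoment] using this

lemma laplaceMoment_lt_top_of_le {Φ : Measure ℝ≥0} [IsProbabilityMeasure Φ] {s t : ℝ}
    (hs : 0 ≤ s) (hst : s ≤ t) (h : laplaceMoment Φ t < ∞) : laplaceMoment Φ s < ∞ :=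
  (laplaceMoment_le_one_add Φ hs hst).trans_lt (ENNReal.add_lt_top.2 ⟨by simp, h⟩)

/-- For a Laplace transform `1 - x^p + O(x^{p+ε})` with `p < 1`, exactly the moments of order
less than `p` are finite. -/
theorem laplaceMoment_lt_top_iff_of_asymptotics {Φ : Measure ℝ≥0} [IsProbabilityMeasure Φ]
    {p ε C : ℝ} (hp1 : p < 1) (hε : 0 < ε)
    (h : ∀ x : ℝ, 0 ≤ x → |laplace Φ x - (1 - x ^ p)| ≤ C * x ^ (p + ε)) {s : ℝ} (hs : 0 < s) :
    laplaceMoment Φ s < ∞ ↔ s < p := by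
  have hC : 0 ≤ C := by simpa using (abs_nonneg _).trans (h 1 zero_le_one)
  constructor
  · intro hfin
    by_contra! hps
    -- The integral formula needs an order in (0, 1), so for s ≥ 1 a smaller order in [p, 1) is
    -- shown to be infinite.
    obtain ⟨t, ht0, ht1, hpt, hts⟩ : ∃ t, 0 < t ∧ t < 1 ∧ p ≤ t ∧ t ≤ s := by
      rcases lt_or_ge s 1 with h1 | h1
      · exact ⟨s, hs, h1, hps, le_rfl⟩
      · refine ⟨(max p 0 + 1) / 2, ?_, ?_, ?_, ?_⟩ <;>
          rcases max_cases p 0 with ⟨h, _⟩ | ⟨h, _⟩ <;> rw [h] <;> linarith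
    have hfin' := laplaceMoment_lt_top_of_le ht0.le hts hfin
    have h1 := laplaceMoment_mul_levyInt Φ ht0 ht1
    -- On (0, b] the error is at most half of x^p; the integrand is then at least x^{p-t-1}/2, which
    -- is not integrable at 0.
    obtain ⟨b, hb0, hb⟩ : ∃ b : ℝ, 0 < b ∧ C * b ^ ε ≤ 1 / 2 := by
      refine ⟨((2 * C + 1)⁻¹) ^ ε⁻¹, by positivity, ?_⟩
      rw [Real.rpow_inv_rpow (by positivity) hε.ne', ← div_eq_mul_inv, div_le_div_iff₀] <;> linarith
    have h2 : ∫⁻ x in Set.Ioc (0 : ℝ) b, ENNReal.ofReal (1 / 2) * ENNReal.ofReal (x ^ (p - t - 1)) ≤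
        ∫⁻ x in Set.Ioi (0 : ℝ), ENNReal.ofReal ((1 - laplace Φ x) * x ^ (-t - 1)) := by
      refine (setLIntegral_mono' measurableSet_Ioc fun x hx => ?_).trans
        (lintegral_mono_set Set.Ioc_subset_Ioi_self)
      have hx0 := hx.1
      rw [← ENNReal.ofReal_mul (by norm_num)]
      refine ENNReal.ofReal_le_ofReal ?_
      have h3 := (abs_le.1 (h x hx0.le)).2
      have h4 : C * x ^ (p + ε) ≤ 1 / 2 * x ^ p := by
        rw [Real.rpow_add hx0, mul_left_comm, mul_comm]
        refine mul_le_mul_of_nonneg_right (le_trans ?_ hb) (by positivity)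
        gcongr
        exact hx.2
      calc 1 / 2 * x ^ (p - t - 1) = (1 / 2 * x ^ p) * x ^ (-t - 1) := by
            rw [mul_assoc, ← Real.rpow_add hx0]; congr 2; ring
        _ ≤ _ := by gcongr; linarith
    rw [lintegral_const_mul _ (by fun_prop), lintegral_Ioc_rpow_eq_top hb0 (by linarith),
      ENNReal.mul_top (by simp), ← h1, top_le_iff] at h2
    exact (ENNReal.mul_lt_top hfin' ENNReal.ofReal_lt_top).ne h2
  · intro hsp
    have hs1 : s < 1 := hsp.trans hp1
    have h1 := laplaceMoment_mul_levyInt Φ hs hs1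
    have hJ := levyInt_pos hs hs1
    suffices hfin : ∫⁻ x in Set.Ioi (0 : ℝ),
        ENNReal.ofReal ((1 - laplace Φ x) * x ^ (-s - 1)) < ∞ by
      rw [← h1] at hfin
      by_contra htop
      rw [not_lt, top_le_iff] at htop
      rw [htop, ENNReal.top_mul (by simpa using hJ)] at hfin
      exact lt_irrefl _ hfin
    have hi : IntegrableOn (fun x : ℝ => (1 + C) * x ^ (p - s - 1)) (Set.Ioc 0 1) :=
      (integrableOn_rpow_Ioc (by linarith)).const_mul _
    have hi2 : IntegrableOn (fun x : ℝ => x ^ (-s - 1)) (Set.Ioi 1) :=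
      integrableOn_Ioi_rpow_of_lt (by linarith) zero_lt_one
    rw [← Set.Ioc_union_Ioi_eq_Ioi (zero_le_one (α := ℝ)),
      lintegral_union measurableSet_Ioi (Set.Ioc_disjoint_Ioi le_rfl), ENNReal.add_lt_top]
    constructor
    · refine lt_of_le_of_lt (setLIntegral_mono' measurableSet_Ioc fun x hx =>
        ENNReal.ofReal_le_ofReal ?_) hi.lintegral_lt_top
      have hx0 := hx.1
      have h3 := (abs_le.1 (h x hx0.le)).1
      have h4 : x ^ (p + ε) ≤ x ^ p :=
        Real.rpow_le_rpow_of_exponent_ge hx0 hx.2 (by linarith)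
      have h5 := mul_le_mul_of_nonneg_left h4 hC
      calc (1 - laplace Φ x) * x ^ (-s - 1) ≤ ((1 + C) * x ^ p) * x ^ (-s - 1) := by
            gcongr; linarith
        _ = _ := by rw [mul_assoc, ← Real.rpow_add hx0]; congr 2; ring
    · refine lt_of_le_of_lt (setLIntegral_mono' measurableSet_Ioi fun x hx =>
        ENNReal.ofReal_le_ofReal ?_) hi2.lintegral_lt_top
      have hx0 : 0 < x := lt_trans zero_lt_one hx
      have := laplace_nonneg Φ x
      exact mul_le_of_le_one_left (by positivity) (by linarith)

/-! ### Powers of sums: pure and mixed terms. -/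

/-- For r ≥ 1 this is the chord of the convex power function over [1, 2]. -/
lemma one_add_rpow_le {t r : ℝ} (ht0 : 0 ≤ t) (ht1 : t ≤ 1) (hr : 0 ≤ r) :
    (1 + t) ^ r ≤ 1 + 2 ^ r * t := by
  rcases le_total r 1 with h | h
  · calc (1 + t) ^ r ≤ (1 + t) ^ (1 : ℝ) := Real.rpow_le_rpow_of_exponent_le (by linarith) h
      _ = 1 + 1 * t := by simp
      _ ≤ _ := by
        gcongr
        exact Real.one_le_rpow (by norm_num) hr
  · have hc := (convexOn_rpow h).2 (show (1 : ℝ) ∈ Set.Ici 0 by simp)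
      (show (2 : ℝ) ∈ Set.Ici 0 by simp) (show 0 ≤ 1 - t by linarith) ht0 (by ring)
    simp only [smul_eq_mul, Real.one_rpow] at hc
    rw [show (1 - t) * 1 + t * 2 = 1 + t by ring] at hc
    linarith

/-- The pure power must carry coefficient exactly one, since in the moment recursion it becomes the
sharp factor λ(s). All losses are put on mixed terms, according to which of a and b is larger. -/
lemma mul_add_rpow_le {a b r : ℝ} (ha : 0 ≤ a) (hb : 0 ≤ b) (hr : 0 ≤ r) :
    a * (a + b) ^ r ≤ a ^ (r + 1) + 2 ^ r * (a * b ^ r + a ^ r * b) := by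
  rcases le_or_gt a b with h | h
  · have h1 : (a + b) ^ r ≤ 2 ^ r * b ^ r := by
      rw [← Real.mul_rpow (by norm_num) hb]
      exact Real.rpow_le_rpow (by linarith) (by linarith) hr
    have h2 := mul_le_mul_of_nonneg_left h1 ha
    have h3 : 0 ≤ a ^ (r + 1) := by positivity
    have h4 : 0 ≤ (2 : ℝ) ^ r * (a ^ r * b) := by positivity
    linarith
  · have ha0 : 0 < a := hb.trans_lt h
    have h1 := one_add_rpow_le (t := b / a) (by positivity) (by rw [div_le_one ha0]; exact h.le) hr
    have h2 : (a + b) ^ r = a ^ r * (1 + b / a) ^ r := by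
      rw [← Real.mul_rpow ha (by positivity)]; congr 1; field_simp
    have h3 : a * (a + b) ^ r ≤ a * (a ^ r * (1 + 2 ^ r * (b / a))) := by
      rw [h2]; gcongr
    have h4 : a * (a ^ r * (1 + 2 ^ r * (b / a))) = a ^ (r + 1) + 2 ^ r * (a ^ r * b) := by
      rw [Real.rpow_add_one ha0.ne']; field_simp
    have h5 : 0 ≤ (2 : ℝ) ^ r * (a * b ^ r) := by positivity
    linarith

/-- A power of a sum exceeds the sum of the powers by at most mixed terms. -/
lemma sum_rpow_le_add_mixed {n : ℕ} (y : Fin n → ℝ≥0) {r : ℝ} (hr : 0 < r) :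
    ((∑ k, y k : ℝ≥0) : ℝ) ^ (r + 1) ≤ ∑ k, (y k : ℝ) ^ (r + 1) +
      2 ^ r * (n : ℝ) ^ r * ∑ i, ∑ j, if j = i then 0 else
        ((y i : ℝ) * (y j : ℝ) ^ r + (y i : ℝ) ^ r * (y j : ℝ)) := by
  classical
  set S : ℝ≥0 := ∑ k, y k with hS
  have hsplit : ∀ i, ((S : ℝ≥0) : ℝ) = (y i : ℝ) +
      ((∑ k, Function.update y i 0 k : ℝ≥0) : ℝ) := by
    intro i
    rw [← NNReal.coe_add, hS, Finset.sum_update_of_mem (Finset.mem_univ i), zero_add,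
      ← Finset.sum_sdiff (Finset.subset_univ {i}), Finset.sum_singleton, add_comm]
  -- One factor S is expanded as ∑ yᵢ; in the i-th term the remaining S^r is split as yᵢ plus the
  -- sum T of the others.
  have h1 : (S : ℝ) ^ (r + 1) = ∑ i, (y i : ℝ) * (S : ℝ) ^ r := by
    rcases eq_or_ne S 0 with h0 | h0
    · simp [h0, Real.zero_rpow hr.ne', Real.zero_rpow (by linarith : r + 1 ≠ 0)]
    · rw [← Finset.sum_mul, Real.rpow_add_one (by exact_mod_cast h0), mul_comm, hS]
      push_cast; rfl
  rw [h1, Finset.mul_sum, ← Finset.sum_add_distrib]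
  refine Finset.sum_le_sum fun i _ => ?_
  have hn : (1 : ℝ) ≤ n := by exact_mod_cast (Fin.pos i)
  have hn1 : (1 : ℝ) ≤ (n : ℝ) ^ r := Real.one_le_rpow hn hr.le
  set T : ℝ≥0 := ∑ k, Function.update y i 0 k with hT
  have h2 := mul_add_rpow_le (y i).coe_nonneg T.coe_nonneg hr.le
  have h3 : (T : ℝ) ^ r ≤ (n : ℝ) ^ r * ∑ j, if j = i then 0 else (y j : ℝ) ^ r := by
    refine (sum_rpow_le_mul_sum_rpow hr).trans_eq ?_
    congr 1
    refine Finset.sum_congr rfl fun j _ => ?_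
    by_cases hj : j = i
    · subst hj; simp [Real.zero_rpow hr.ne']
    · simp [hj]
  have h4 : (T : ℝ) ≤ (n : ℝ) ^ r * ∑ j, if j = i then 0 else (y j : ℝ) := by
    have : (T : ℝ) = ∑ j, if j = i then 0 else (y j : ℝ) := by
      rw [hT, NNReal.coe_sum]
      refine Finset.sum_congr rfl fun j _ => ?_
      by_cases hj : j = i
      · subst hj; simp
      · simp [hj]
    rw [← this]
    exact le_mul_of_one_le_left T.coe_nonneg hn1
  rw [hsplit i]
  refine h2.trans (add_le_add le_rfl ?_)
  rw [mul_assoc]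
  gcongr
  have h5 : (∑ j, if j = i then 0 else ((y i : ℝ) * (y j : ℝ) ^ r + (y i : ℝ) ^ r * (y j : ℝ))) =
      (y i : ℝ) * (∑ j, if j = i then 0 else (y j : ℝ) ^ r) +
        (y i : ℝ) ^ r * (∑ j, if j = i then 0 else (y j : ℝ)) := by
    rw [Finset.mul_sum, Finset.mul_sum, ← Finset.sum_add_distrib]
    refine Finset.sum_congr rfl fun j _ => ?_
    split_ifs <;> simp
  rw [h5]
  have h6 := mul_le_mul_of_nonneg_left h3 (y i).coe_nonneg
  have h7 := mul_le_mul_of_nonneg_left h4 (by positivity : 0 ≤ (y i : ℝ) ^ r)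
  calc _ ≤ _ := add_le_add h6 h7
    _ = _ := by ring

lemma sum_rpow_le_rpow_sum {ι : Type*} (A : Finset ι) (y : ι → ℝ) (hy : ∀ k, 0 ≤ y k) {s : ℝ}
    (hs : 1 ≤ s) : ∑ k ∈ A, y k ^ s ≤ (∑ k ∈ A, y k) ^ s := by
  classical
  induction A using Finset.induction_on with
  | empty => simp [Real.zero_rpow (by linarith : s ≠ 0)]
  | insert i A hi ih =>
    rw [Finset.sum_insert hi, Finset.sum_insert hi]
    exact (add_le_add le_rfl ih).trans
      (Real.add_rpow_le_rpow_add (hy i) (Finset.sum_nonneg fun k _ => hy k) hs)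

open ProbabilityTheory in
lemma lintegral_pi_mul {n : ℕ} (R : Measure ℝ≥0) [IsProbabilityMeasure R] {i j : Fin n}
    (hij : i ≠ j) {f g : ℝ≥0 → ℝ≥0∞} (hf : Measurable f) (hg : Measurable g) :
    ∫⁻ t, f (t i) * g (t j) ∂(Measure.pi fun _ : Fin n => R) =
      (∫⁻ v, f v ∂(R)) * ∫⁻ v, g v ∂(R) := by
  have hind := (iIndepFun_pi (μ := fun _ : Fin n => R) (X := fun _ v => v)
    fun _ => aemeasurable_id).indepFun hij
  have h2 := lintegral_mul_eq_lintegral_mul_lintegral_of_indepFun''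
    (μ := Measure.pi fun _ : Fin n => R) (f := fun t => f (t i)) (g := fun t => g (t j))
    (hf.comp (measurable_pi_apply i)).aemeasurable (hg.comp (measurable_pi_apply j)).aemeasurable
    (hind.comp hf hg)
  rw [h2, lintegral_pi_apply R i hf, lintegral_pi_apply R j hg]

/-- Independence factors the mixed terms into moments of orders 1 and r, both below r + 1 when r >
0. -/
lemma lintegral_pi_mixed_le {n : ℕ} (R : Measure ℝ≥0) [IsProbabilityMeasure R] {r b : ℝ}
    (hr : 0 < r) (hb : 0 ≤ b) {a : Fin n → ℝ≥0} (ha : ∀ k, (a k : ℝ) ≤ b) {i j : Fin n}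
    (hij : j ≠ i) : ∫⁻ t, ENNReal.ofReal
      (((a i * t i : ℝ≥0) : ℝ) * ((a j * t j : ℝ≥0) : ℝ) ^ r +
        ((a i * t i : ℝ≥0) : ℝ) ^ r * ((a j * t j : ℝ≥0) : ℝ)) ∂(Measure.pi fun _ : Fin n => R) ≤
      ENNReal.ofReal (2 * b ^ (r + 1)) * (laplaceMoment R 1 * laplaceMoment R r) := by
  have hbr : b ^ (r + 1) = b * b ^ r := by
    rw [mul_comm, Real.rpow_add_one' hb (by linarith)]
  have key : ∀ i j : Fin n, j ≠ i → ∫⁻ t, ENNReal.ofReal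
      (((a i * t i : ℝ≥0) : ℝ) * ((a j * t j : ℝ≥0) : ℝ) ^ r) ∂(Measure.pi fun _ : Fin n => R) ≤
      ENNReal.ofReal (b ^ (r + 1)) * (laplaceMoment R 1 * laplaceMoment R r) := by
    intro i j hij
    rw [laplaceMoment, laplaceMoment, ← lintegral_pi_mul R hij.symm (by fun_prop) (by fun_prop),
      ← lintegral_const_mul _ (by fun_prop)]
    refine lintegral_mono fun t => ?_
    rw [← ENNReal.ofReal_mul (by positivity), ← ENNReal.ofReal_mul (by positivity)]
    refine ENNReal.ofReal_le_ofReal ?_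
    rw [NNReal.coe_mul, NNReal.coe_mul, Real.mul_rpow (by positivity) (by positivity),
      Real.rpow_one, hbr]
    calc (a i : ℝ) * t i * ((a j : ℝ) ^ r * (t j : ℝ) ^ r)
        = ((a i : ℝ) * (a j : ℝ) ^ r) * ((t i : ℝ) * (t j : ℝ) ^ r) := by ring
      _ ≤ (b * b ^ r) * ((t i : ℝ) * (t j : ℝ) ^ r) := by
        gcongr
        · exact ha i
        · exact ha j
  simp_rw [ENNReal.ofReal_add
    (mul_nonneg (NNReal.coe_nonneg _) (Real.rpow_nonneg (NNReal.coe_nonneg _) r))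
    (mul_nonneg (Real.rpow_nonneg (NNReal.coe_nonneg _) r) (NNReal.coe_nonneg _))]
  rw [lintegral_add_left (by fun_prop), two_mul, ENNReal.ofReal_add (by positivity)
    (by positivity), add_mul]
  refine add_le_add (key i j hij) ?_
  simp_rw [mul_comm (((a i * _ : ℝ≥0) : ℝ) ^ r)]
  exact key j i hij.symm

namespace MaxwellModel

variable {N : ℕ}

/-- The constant D does not depend on R, so the estimate can be used at every step of the iteration.
-/
lemma exists_sumMoment_le (M : MaxwellModel N) {r : ℝ} (hr : 0 < r) :
    ∃ D : ℝ, 0 ≤ D ∧ ∀ (R : Measure ℝ≥0) [IsProbabilityMeasure R],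
      M.sumMoment 1 R (r + 1) ≤ ENNReal.ofReal (M.lam (r + 1)) * laplaceMoment R (r + 1) +
        ENNReal.ofReal D * (laplaceMoment R 1 * laplaceMoment R r) := by
  obtain ⟨b, hb, hbd⟩ := M.exists_bound
  refine ⟨2 ^ r * (N : ℝ) ^ r * (N * (N * (2 * b ^ (r + 1)))), by positivity, fun R _ => ?_⟩
  set m := laplaceMoment R 1 * laplaceMoment R r with hm
  have hsum := M.sum_lintegral_rpow zero_le_one (σ := r + 1) (by linarith) R
  rw [one_mul] at hsum
  rw [← hsum, ← one_mul (ENNReal.ofReal (2 ^ r * _ * _) * m), ← M.sum_ofReal_α, Finset.sum_mul,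
    ← Finset.sum_add_distrib, sumMoment]
  refine Finset.sum_le_sum fun i _ => ?_
  rw [← mul_add]
  gcongr
  have hN : ((i.val + 1 : ℕ) : ℝ) ≤ N := by exact_mod_cast i.isLt
  have hmix : ∀ a : Fin (i.val + 1) → ℝ≥0, (∀ k, (a k : ℝ) ≤ b) →
      ∫⁻ t, ENNReal.ofReal (((∑ k, (a k) ^ (1 : ℝ) * t k : ℝ≥0) : ℝ) ^ (r + 1))
        ∂(Measure.pi fun _ : Fin (i.val + 1) => R) ≤
      (∫⁻ t, ENNReal.ofReal (∑ k, (((a k) ^ (1 : ℝ) * t k : ℝ≥0) : ℝ) ^ (r + 1))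
        ∂(Measure.pi fun _ : Fin (i.val + 1) => R)) +
      ENNReal.ofReal (2 ^ r * (N : ℝ) ^ r * (N * (N * (2 * b ^ (r + 1))))) * m := by
    intro a ha
    simp only [NNReal.rpow_one]
    set f : (Fin (i.val + 1) → ℝ≥0) → Fin (i.val + 1) → Fin (i.val + 1) → ℝ := fun t k l =>
      if l = k then 0 else (((a k * t k : ℝ≥0) : ℝ) * ((a l * t l : ℝ≥0) : ℝ) ^ r +
        ((a k * t k : ℝ≥0) : ℝ) ^ r * ((a l * t l : ℝ≥0) : ℝ)) with hf
    have hf0 : ∀ t k l, 0 ≤ f t k l := fun t k l => by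
      simp only [hf]; split_ifs <;> positivity
    have hfm : ∀ k l, Measurable fun t => ENNReal.ofReal (f t k l) := fun k l => by
      simp only [hf]
      split_ifs <;> fun_prop
    calc _ ≤ ∫⁻ t, (ENNReal.ofReal (∑ k, ((a k * t k : ℝ≥0) : ℝ) ^ (r + 1)) +
          ENNReal.ofReal (2 ^ r * (N : ℝ) ^ r) * ∑ k, ∑ l, ENNReal.ofReal (f t k l))
          ∂(Measure.pi fun _ : Fin (i.val + 1) => R) := by
          refine lintegral_mono fun t => ?_
          simp_rw [← ENNReal.ofReal_sum_of_nonneg fun l _ => hf0 t _ l]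
          rw [← ENNReal.ofReal_sum_of_nonneg fun k _ => Finset.sum_nonneg fun l _ => hf0 t k l,
            ← ENNReal.ofReal_mul (by positivity), ← ENNReal.ofReal_add
              (Finset.sum_nonneg fun k _ => by positivity)
              (mul_nonneg (by positivity) (Finset.sum_nonneg fun k _ =>
                Finset.sum_nonneg fun l _ => hf0 t k l))]
          refine ENNReal.ofReal_le_ofReal ((sum_rpow_le_add_mixed _ hr).trans ?_)
          refine add_le_add le_rfl (mul_le_mul_of_nonneg_right ?_
            (Finset.sum_nonneg fun k _ => Finset.sum_nonneg fun l _ => hf0 t k l))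
          gcongr
      _ ≤ _ := by
          rw [lintegral_add_left (by fun_prop), lintegral_const_mul _
            (Finset.measurable_fun_sum _ fun k _ => Finset.measurable_fun_sum _ fun l _ => hfm k l),
            lintegral_finsetSum _ fun k _ => Finset.measurable_fun_sum _ fun l _ => hfm k l,
            ENNReal.ofReal_mul (p := 2 ^ r * (N : ℝ) ^ r) (by positivity), mul_assoc]
          refine add_le_add le_rfl (mul_le_mul_right ?_ _)
          calc _ ≤ ∑ k : Fin (i.val + 1), ∑ l : Fin (i.val + 1),
                ENNReal.ofReal (2 * b ^ (r + 1)) * m := by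
                refine Finset.sum_le_sum fun k _ => ?_
                rw [lintegral_finsetSum _ fun l _ => hfm k l]
                refine Finset.sum_le_sum fun l _ => ?_
                by_cases hl : l = k
                · simp [hf, hl]
                · simp only [hf, if_neg hl]
                  exact lintegral_pi_mixed_le R hr hb.le ha hl
            _ = ENNReal.ofReal ((i.val + 1 : ℕ) * ((i.val + 1 : ℕ) * (2 * b ^ (r + 1)))) * m := by
                simp only [Finset.sum_const, Finset.card_univ, Fintype.card_fin, nsmul_eq_mul]
                rw [ENNReal.ofReal_mul (p := ((i.val + 1 : ℕ) : ℝ)) (by positivity),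
                  ENNReal.ofReal_mul (p := ((i.val + 1 : ℕ) : ℝ)) (by positivity),
                  ENNReal.ofReal_natCast, mul_assoc, mul_assoc]
            _ ≤ _ := by gcongr
  refine (lintegral_mono_ae ((hbd i).mono fun a ha => hmix a ha)).trans_eq ?_
  rw [lintegral_add_right _ (by fun_prop)]
  simp

/-! ### Convexity of λ and the sign of μ(s) - c. -/

lemma integrable_rpow_K (M : MaxwellModel N) {s : ℝ} (hs : 0 ≤ s) :
    Integrable (fun a : ℝ≥0 => (a : ℝ) ^ s) M.K := by
  rw [K, integrable_finsetSum_measure]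
  intro i _
  refine Integrable.smul_measure ?_ ENNReal.ofReal_ne_top
  rw [integrable_finsetSum_measure]
  intro k _
  rw [integrable_map_measure (Measurable.aestronglyMeasurable (by fun_prop))
    (measurable_apply_fin k).aemeasurable]
  exact M.integrable_rpow_apply hs i k

/-- For each a > 0 the map s ↦ a^s is convex by the weighted mean inequality, and a = 0 contributes
nothing at positive exponents. -/
lemma convexOn_lam (M : MaxwellModel N) : ConvexOn ℝ (Set.Ioi 0) M.lam := by
  refine ⟨convex_Ioi 0, fun x hx z hz a b ha hb hab => ?_⟩
  have hx0 : (0 : ℝ) < x := hx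
  have hz0 : (0 : ℝ) < z := hz
  simp only [smul_eq_mul, lam]
  rw [← integral_const_mul, ← integral_const_mul,
    ← integral_add ((M.integrable_rpow_K hx0.le).const_mul a)
      ((M.integrable_rpow_K hz0.le).const_mul b)]
  have hpos : 0 < a * x + b * z := by
    rcases ha.eq_or_lt with rfl | ha'
    · have : b = 1 := by linarith
      subst this; linarith
    · have := mul_pos ha' hx0
      have := mul_nonneg hb hz0.le
      linarith
  refine integral_mono (M.integrable_rpow_K hpos.le)
    (((M.integrable_rpow_K hx0.le).const_mul a).add ((M.integrable_rpow_K hz0.le).const_mul b))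
    fun c => ?_
  dsimp only
  rcases c.coe_nonneg.eq_or_lt with h0 | h0
  · rw [← h0, Real.zero_rpow hpos.ne', Real.zero_rpow hx0.ne', Real.zero_rpow hz0.ne']
    simp
  · rw [Real.rpow_add h0, mul_comm a x, mul_comm b z, Real.rpow_mul h0.le, Real.rpow_mul h0.le]
    exact Real.geom_mean_le_arith_mean2_weighted ha hb (by positivity) (by positivity) hab

lemma continuousOn_mu (M : MaxwellModel N) : ContinuousOn M.mu (Set.Ioi 0) := by
  have h := M.convexOn_lam.continuousOn isOpen_Ioi
  unfold mu
  exact (h.sub continuousOn_const).div continuousOn_id fun x hx => ne_of_gt hx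

/-- Convexity of `s ↦ λ(s) - 1 - c s`, in terms of `μ`. -/
lemma mul_mu_sub_le (M : MaxwellModel N) {x y z : ℝ} (c : ℝ) (hx : 0 < x) (hxy : x < y)
    (hyz : y < z) : (z - x) * (y * (M.mu y - c)) ≤
      (z - y) * (x * (M.mu x - c)) + (y - x) * (z * (M.mu z - c)) := by
  have hxz : 0 < z - x := by linarith
  have h := M.convexOn_lam.2 (show x ∈ Set.Ioi 0 from hx) (show z ∈ Set.Ioi 0 from by
    simp only [Set.mem_Ioi]; linarith)
    (show 0 ≤ (z - y) / (z - x) from div_nonneg (by linarith) hxz.le)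
    (show 0 ≤ (y - x) / (z - x) from div_nonneg (by linarith) hxz.le) (by field_simp; ring)
  have hy : (z - y) / (z - x) * x + (y - x) / (z - x) * z = y := by field_simp; ring
  simp only [smul_eq_mul, hy] at h
  rw [M.lam_eq_one_add hx.ne', M.lam_eq_one_add (show y ≠ 0 by linarith),
    M.lam_eq_one_add (show z ≠ 0 by linarith)] at h
  have h2 := mul_le_mul_of_nonneg_left h hxz.le
  have h3 : (z - x) * ((z - y) / (z - x) * (1 + M.mu x * x) +
      (y - x) / (z - x) * (1 + M.mu z * z)) =
      (z - y) * (1 + M.mu x * x) + (y - x) * (1 + M.mu z * z) := by field_simp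
  rw [h3] at h2
  linarith

/-- The convex function s(μ(s) - c) is negative at points arbitrarily close to s₀ on the right and
vanishes at t, hence is negative in between. -/
lemma mu_lt_of_mu_eq (M : MaxwellModel N) {s₀ s t c : ℝ} (h0 : 0 < s₀)
    (hlt : ∀ s, s₀ < s → ∃ s', s₀ < s' ∧ s' < s ∧ M.mu s' < c) (hs : s₀ < s) (hst : s < t)
    (ht : M.mu t = c) : M.mu s < c := by
  obtain ⟨x, hx0, hxs, hx⟩ := hlt s hs
  have hxp : 0 < x := h0.trans hx0
  have h := M.mul_mu_sub_le c hxp hxs hst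
  rw [ht, sub_self, mul_zero, mul_zero, add_zero] at h
  by_contra! hc
  have h1 : 0 ≤ (t - x) * (s * (M.mu s - c)) :=
    mul_nonneg (by linarith) (mul_nonneg (by linarith) (by linarith))
  have h2 : (t - s) * (x * (M.mu x - c)) < 0 :=
    mul_neg_of_pos_of_neg (by linarith) (mul_neg_of_pos_of_neg hxp (by linarith))
  linarith

/-- The same convex function, negative at x and zero at t, must be positive after t. -/
lemma lt_mu_of_mu_eq (M : MaxwellModel N) {x s t c : ℝ} (h0 : 0 < x) (hx : M.mu x < c)
    (hxt : x < t) (hts : t < s) (ht : M.mu t = c) : c < M.mu s := by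
  have h := M.mul_mu_sub_le c h0 hxt hts
  rw [ht, sub_self, mul_zero, mul_zero] at h
  by_contra! hc
  have h1 : (t - x) * (s * (M.mu s - c)) ≤ 0 :=
    mul_nonpos_of_nonneg_of_nonpos (by linarith)
      (mul_nonpos_of_nonneg_of_nonpos (by linarith) (by linarith))
  have h2 : (s - t) * (x * (M.mu x - c)) < 0 :=
    mul_neg_of_pos_of_neg (by linarith) (mul_neg_of_pos_of_neg h0 (by linarith))
  linarith

lemma mu_lt_of_forall_ne (M : MaxwellModel N) {x t c : ℝ} (h0 : 0 < x) (hx : M.mu x < c)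
    (hxt : x ≤ t) (hne : ∀ s, x ≤ s → M.mu s ≠ c) : M.mu t < c := by
  by_contra! hc
  have hcont : ContinuousOn M.mu (Set.Icc x t) :=
    M.continuousOn_mu.mono fun s hs => lt_of_lt_of_le h0 hs.1
  obtain ⟨s, hs, hsc⟩ := intermediate_value_Icc hxt hcont ⟨hx.le, hc⟩
  exact hne s hs.1 hsc

/-! ### Bounded moments along the iteration for p = 1. -/

/-- Moments of the iterated smoothing transform are bounded below the second root. -/
lemma exists_laplaceMoment_iterate_le (M : MaxwellModel N) (hc : -1 < M.mu 1) (k : ℕ) :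
    ∀ s : ℝ, 0 < s → s ≤ k + 1 → (∀ t, 1 < t → t ≤ s → M.mu t < M.mu 1) →
      ∃ b : ℝ, 0 ≤ b ∧ ∀ n, laplaceMoment ((M.smooth (M.mu 1) 1)^[n] (Measure.dirac 1)) s ≤
        ENNReal.ofReal b := by
  have hm1 : ∀ n, laplaceMoment ((M.smooth (M.mu 1) 1)^[n] (Measure.dirac 1)) 1 = 1 := by
    intro n
    induction n with
    | zero => exact laplaceMoment_dirac_one 1
    | succ n ih =>
      rw [Function.iterate_succ_apply', M.laplaceMoment_one_smooth one_pos (by simpa using hc), ih]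
  have hle1 : ∀ s : ℝ, 0 < s → s ≤ 1 → ∃ b : ℝ, 0 ≤ b ∧
      ∀ n, laplaceMoment ((M.smooth (M.mu 1) 1)^[n] (Measure.dirac 1)) s ≤ ENNReal.ofReal b := by
    intro s hs hs1
    refine ⟨2, by norm_num, fun n => ?_⟩
    refine (laplaceMoment_le_one_add _ hs.le hs1).trans ?_
    rw [hm1, ENNReal.ofReal_ofNat, one_add_one_eq_two]
  induction k with
  | zero => exact fun s hs hs1 _ => hle1 s hs (by simpa using hs1)
  | succ k ih =>
    intro s hs hsk hmu
    rcases le_or_gt s 1 with hs1 | hs1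
    · exact hle1 s hs hs1
    -- The mixed terms at order s need only the mean, which stays one, and the moment of order s -
    -- 1.
    obtain ⟨b, hb0, hb⟩ := ih (s - 1) (by linarith) (by push_cast at hsk; linarith)
      fun t ht hts => hmu t ht (by linarith)
    obtain ⟨D, hD0, hD⟩ := M.exists_sumMoment_le (r := s - 1) (by linarith)
    rw [sub_add_cancel] at hD
    have hms := hmu s hs1 le_rfl
    have hcs := M.neg_one_lt_of_mu_lt hs hms
    have hθ0 := M.contraction_nonneg hcs
    have hθ := M.contraction_lt_one hs hms
    set θ := M.lam s / (1 + M.mu 1 * s) with hθd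
    set E := (1 + M.mu 1 * s)⁻¹ * (D * b) with hE
    have h1cs : 0 < (1 + M.mu 1 * s)⁻¹ := by rw [inv_pos]; linarith
    have hE0 : 0 ≤ E := by positivity
    have hθ1 : 0 < 1 - θ := by linarith
    -- A bound preserved by m ↦ θm + E; the summand 1 makes it dominate the moment of the unit mass
    -- at the start.
    refine ⟨(1 + E) / (1 - θ), by positivity, fun n => ?_⟩
    induction n with
    | zero =>
      rw [Function.iterate_zero, id, laplaceMoment_dirac_one, ENNReal.one_le_ofReal,
        le_div_iff₀ hθ1]
      linarith
    | succ n ihn =>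
      rw [Function.iterate_succ_apply', M.laplaceMoment_smooth, mul_one, lintegral_rpow_Ioc hcs]
      have h1 := hD ((M.smooth (M.mu 1) 1)^[n] (Measure.dirac 1))
      rw [hm1 n, one_mul] at h1
      calc _ ≤ ENNReal.ofReal (1 + M.mu 1 * s)⁻¹ * (ENNReal.ofReal (M.lam s) *
            ENNReal.ofReal ((1 + E) / (1 - θ)) + ENNReal.ofReal D * ENNReal.ofReal b) := by
              gcongr
              refine h1.trans ?_
              gcongr
              exact hb n
        _ = ENNReal.ofReal (θ * ((1 + E) / (1 - θ)) + E) := by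
              rw [← ENNReal.ofReal_mul (M.lam_nonneg s), ← ENNReal.ofReal_mul hD0,
                ← ENNReal.ofReal_add (mul_nonneg (M.lam_nonneg s) (by positivity)) (by positivity),
                ← ENNReal.ofReal_mul h1cs.le, hE, hθd]
              congr 1
              ring
        _ ≤ _ := by
              refine ENNReal.ofReal_le_ofReal ?_
              rw [div_eq_mul_inv]
              have : (1 + E) * (1 - θ)⁻¹ * (1 - θ) = 1 + E := by field_simp
              linarith

/-! ### The moment identity for fixed points. -/

/-- The moment identity behind the functionals `I`. -/
lemma sumMoment_eq (M : MaxwellModel N) (R : Measure ℝ≥0) [IsProbabilityMeasure R] {s : ℝ}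
    (hs : 1 ≤ s) : M.sumMoment 1 R s = ∑ i, ENNReal.ofReal (M.α i) * M.I R i s +
      ENNReal.ofReal (M.lam s) * laplaceMoment R s := by
  have h := M.sum_lintegral_rpow zero_le_one (σ := s) (by linarith) R
  rw [one_mul] at h
  rw [← h, ← Finset.sum_add_distrib, sumMoment]
  refine Finset.sum_congr rfl fun i _ => ?_
  rw [← mul_add, I, ← lintegral_add_right _ (by fun_prop)]
  congr 1
  refine lintegral_congr fun a => ?_
  rw [← lintegral_add_right _ (by fun_prop)]
  refine lintegral_congr fun t => ?_
  simp only [NNReal.rpow_one]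
  have h0 : 0 ≤ ∑ k, ((a k * t k : ℝ≥0) : ℝ) ^ s := Finset.sum_nonneg fun k _ => by positivity
  have h1 := sum_rpow_le_rpow_sum Finset.univ (fun k => ((a k * t k : ℝ≥0) : ℝ))
    (fun k => NNReal.coe_nonneg _) hs
  rw [← ENNReal.ofReal_add (sub_nonneg.2 h1) h0, sub_add_cancel, NNReal.coe_sum]

/-- The moment identity for a fixed point of the smoothing transform with a finite moment. -/
lemma moment_identity_of_fixed (M : MaxwellModel N) {R : Measure ℝ≥0} [IsProbabilityMeasure R]
    {c s : ℝ} (hR : M.smooth c 1 R = R) (hs : 1 ≤ s) (h0 : laplaceMoment R s ≠ 0)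
    (hfin : laplaceMoment R s < ∞) : 0 < 1 + c * s ∧
      ENNReal.ofReal (1 + c * s) * laplaceMoment R s =
        ∑ i, ENNReal.ofReal (M.α i) * M.I R i s + ENNReal.ofReal (M.lam s) * laplaceMoment R s := by
  have h := M.laplaceMoment_smooth c 1 R s
  rw [hR, mul_one] at h
  -- Otherwise the average over τ diverges and the moment would be zero or infinite.
  have hc : -1 < c * s := by
    by_contra! hc
    rw [lintegral_Ioc_rpow_eq_top one_pos hc] at h
    rcases eq_or_ne (M.sumMoment 1 R s) 0 with hz | hz
    · rw [hz, mul_zero] at h; exact h0 h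
    · rw [ENNReal.top_mul hz] at h; exact hfin.ne h
  have hpos : 0 < 1 + c * s := by linarith
  refine ⟨hpos, ?_⟩
  rw [← M.sumMoment_eq R hs]
  rw [lintegral_rpow_Ioc hc] at h
  nth_rewrite 1 [h]
  rw [← mul_assoc, ← ENNReal.ofReal_mul hpos.le, mul_inv_cancel₀ hpos.ne', ENNReal.ofReal_one,
    one_mul]

/-- The nonnegative interaction terms are dropped from the identity and the finite nonzero moment is
cancelled. -/
lemma lam_le_of_fixed (M : MaxwellModel N) {R : Measure ℝ≥0} [IsProbabilityMeasure R]
    {c s : ℝ} (hR : M.smooth c 1 R = R) (hs : 1 ≤ s) (h0 : laplaceMoment R s ≠ 0)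
    (hfin : laplaceMoment R s < ∞) : M.lam s ≤ 1 + c * s := by
  obtain ⟨hpos, h⟩ := M.moment_identity_of_fixed hR hs h0 hfin
  have h1 : ENNReal.ofReal (M.lam s) * laplaceMoment R s ≤
      ENNReal.ofReal (1 + c * s) * laplaceMoment R s := by
    rw [h]; exact le_add_self
  rw [ENNReal.mul_le_mul_iff_left h0 hfin.ne, ENNReal.ofReal_le_ofReal_iff hpos.le] at h1
  exact h1

/-- At μ(s) = c both sides contain the same finite moment term, so the sum of nonnegative
interaction terms is zero. -/
lemma I_eq_zero_of_fixed (M : MaxwellModel N) {R : Measure ℝ≥0} [IsProbabilityMeasure R]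
    {c s : ℝ} (hR : M.smooth c 1 R = R) (hs : 1 ≤ s) (h0 : laplaceMoment R s ≠ 0)
    (hfin : laplaceMoment R s < ∞) (hmu : M.mu s = c) (i : Fin N) (hi : 0 < M.α i) :
    M.I R i s = 0 := by
  obtain ⟨hpos, h⟩ := M.moment_identity_of_fixed hR hs h0 hfin
  rw [M.lam_eq_one_add (by linarith : s ≠ 0), hmu] at h
  have hne : ENNReal.ofReal (1 + c * s) * laplaceMoment R s ≠ ∞ :=
    (ENNReal.mul_lt_top ENNReal.ofReal_lt_top hfin).ne
  have hz : ∑ i, ENNReal.ofReal (M.α i) * M.I R i s = 0 := by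
    have h2 : 0 + ENNReal.ofReal (1 + c * s) * laplaceMoment R s =
        ∑ i, ENNReal.ofReal (M.α i) * M.I R i s +
          ENNReal.ofReal (1 + c * s) * laplaceMoment R s := by rw [zero_add]; exact h
    exact ((ENNReal.add_left_inj hne).1 h2).symm
  have h3 := (Finset.sum_eq_zero_iff.1 hz) i (Finset.mem_univ i)
  rcases mul_eq_zero.1 h3 with h4 | h4
  · rw [ENNReal.ofReal_eq_zero] at h4; linarith
  · exact h4

lemma MomentAlternative.congr {M : MaxwellModel N} {R : Measure ℝ≥0} {m m' : ℝ → ℝ≥0∞}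
    (h : M.MomentAlternative R m) (hm : ∀ s, 0 < s → (m' s < ∞ ↔ m s < ∞)) :
    M.MomentAlternative R m' := by
  obtain ⟨h1, h2⟩ := h
  refine ⟨fun hu s hs => (hm s hs).2 (h1 hu s hs), fun t ht hmu => ?_⟩
  obtain ⟨h3, h4, h5⟩ := h2 t ht hmu
  refine ⟨fun s hs hst => (hm s hs).2 (h3 s hs hst), fun s hst => ?_, fun hlt => ?_⟩
  · by_contra hne
    exact ((hm s (by linarith)).1 (lt_top_iff_ne_top.2 hne)).ne (h4 s hst)
  · exact h5 ((hm t (by linarith)).1 hlt)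

end MaxwellModel

/-! ### The moment alternative at p = 1. -/

lemma laplaceMoment_ne_zero {R : Measure ℝ≥0} [IsProbabilityMeasure R] {s : ℝ}
    {y : ℝ} (hy : laplace R y ≠ 1) : laplaceMoment R s ≠ 0 := by
  intro h0
  rw [laplaceMoment, lintegral_eq_zero_iff (by fun_prop)] at h0
  refine hy ?_
  have h1 : ∀ᵐ v ∂(R), v = 0 := by
    filter_upwards [h0] with v hv
    simp only [Pi.zero_apply, ENNReal.ofReal_eq_zero] at hv
    by_contra hne
    have : 0 < v := pos_iff_ne_zero.2 hne
    have : 0 < (v : ℝ) ^ s := by positivity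
    linarith
  rw [laplace, integral_congr_ae (g := fun _ => (1 : ℝ))]
  · simp
  · filter_upwards [h1] with v hv
    simp [hv]

namespace MaxwellModel

variable {N : ℕ}

/-- At a point y > 0 with C y^ε < 1, the term y^p outweighs the error. This excludes the unit mass
at 0, for which the moment identity is void. -/
lemma IsProfile.exists_ne_one {M : MaxwellModel N} {p : ℝ} {ψ : ℝ≥0 → ℝ}
    (h : M.IsProfile p ψ) : ∃ x, ψ x ≠ 1 := by
  by_contra! h1
  obtain ⟨ε, hε, C, hC⟩ := h.asymptotics
  have hC0 : 0 ≤ C := by simpa using (abs_nonneg _).trans (hC 1)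
  obtain ⟨y, hyd⟩ : ∃ y : ℝ≥0, (y : ℝ) = ((2 * C + 1)⁻¹) ^ ε⁻¹ :=
    ⟨Real.toNNReal _, Real.coe_toNNReal _ (by positivity)⟩
  have hy0 : (0 : ℝ) < y := by rw [hyd]; positivity
  have hyε : (y : ℝ) ^ ε = (2 * C + 1)⁻¹ := by
    rw [hyd, Real.rpow_inv_rpow (by positivity) hε.ne']
  have h2 := hC y
  have hyp : 0 < (y : ℝ) ^ p := by positivity
  rw [h1, sub_sub_cancel, abs_of_pos hyp, Real.rpow_add hy0, hyε] at h2
  have h3 : C * (2 * C + 1)⁻¹ < 1 := by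
    rw [← div_eq_mul_inv, div_lt_one (by linarith)]; linarith
  have h4 : (y : ℝ) ^ p * (C * (2 * C + 1)⁻¹) < (y : ℝ) ^ p * 1 := by gcongr
  linarith

theorem momentAlternative_laplaceMoment (M : MaxwellModel N)
    (hpc : ENNReal.ofReal 1 < M.critExp) {ψ : ℝ≥0 → ℝ} {R : Measure ℝ≥0}
    (hψ : M.IsProfile 1 ψ) (hR : IsMixingMeasure 1 ψ R) :
    M.MomentAlternative R (laplaceMoment R) := by
  have hRp := hR.1
  obtain ⟨r, hr, hr2, -, hmu⟩ := M.exists_exponent one_pos hpc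
  have hmr := hmu r hr le_rfl
  have hc : -1 < M.mu 1 := by
    simpa using neg_one_lt_mul_of_le one_pos hr.le (M.neg_one_lt_of_mu_lt (by linarith) hmr)
  have hlap : ∀ x : ℝ≥0, laplace R ((x : ℝ) ^ (1 : ℝ)) = ψ x := hR.2
  have hlap1 : ∀ x : ℝ≥0, laplace R x = ψ x := fun x => by rw [← hlap, Real.rpow_one]
  have hext : ∀ Q : Measure ℝ≥0, IsProbabilityMeasure Q →
      (∀ x : ℝ≥0, laplace Q ((x : ℝ) ^ (1 : ℝ)) = ψ x) → Q = R := fun Q hQ h =>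
    ext_of_laplace fun y hy => by
      lift y to ℝ≥0 using hy
      rw [← Real.rpow_one (y : ℝ), h, hlap]
  have hfix : M.smooth (M.mu 1) 1 R = R := by
    refine hext _ inferInstance fun x => ?_
    rw [M.laplace_smooth (M.mu 1) one_pos, funext hlap]
    exact (hψ.equation x).symm
  have hne : ∀ s, laplaceMoment R s ≠ 0 := fun s => by
    obtain ⟨x, hx⟩ := hψ.exists_ne_one
    exact laplaceMoment_ne_zero (y := x) (by rwa [hlap1])
  have hfinite : ∀ s, 0 < s → (∀ t, 1 < t → t ≤ s → M.mu t < M.mu 1) →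
      laplaceMoment R s < ∞ := by
    intro s hs h
    obtain ⟨k, hk⟩ := exists_nat_ge s
    obtain ⟨b, -, hb⟩ := M.exists_laplaceMoment_iterate_le hc k s hs (by linarith) h
    -- Uniqueness of the profile makes ψ the limit of the iteration from the unit mass; the limit
    -- measure inherits the moment bounds and equals R by uniqueness of transforms.
    obtain ⟨Q, hQ, hQψ, hQle⟩ := M.exists_measure_of_tendsto one_pos hr.le hr2 hmr
      (hψ.tendsto_iterate one_pos hr hr2 hmu) one_pos (Measure.dirac 1)
      (C := 0) (fun x => by simp [laplace_dirac_one, expPow])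
    rw [← hext Q hQ hQψ]
    exact (hQle (fun v => (v : ℝ) ^ s) _
      (NNReal.continuous_coe.rpow_const fun _ => Or.inr hs.le) (fun v => by positivity)
      hb).trans_lt ENNReal.ofReal_lt_top
  refine ⟨fun huniq s hs => hfinite s hs fun t ht _ => ?_, fun t ht hmt => ⟨fun s hs hst => ?_,
    fun s hts => ?_, fun hlt i _ hi => ?_⟩⟩
  · rcases le_total t r with htr | htr
    · exact hmu t ht htr
    · refine M.mu_lt_of_forall_ne (by linarith) hmr htr fun u hu hmuu => ?_
      have := huniq u (by linarith) hmuu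
      linarith
  · refine hfinite s hs fun u hu hus => M.mu_lt_of_mu_eq one_pos (fun v hv => ?_) hu
      (hus.trans_lt hst) hmt
    -- A point of (1, r) below v, where μ < μ(1) by strict monotonicity before p₀.
    refine ⟨(1 + min r v) / 2, ?_, ?_, hmu _ ?_ ?_⟩ <;>
      rcases min_cases r v with ⟨h, _⟩ | ⟨h, _⟩ <;> rw [h] <;> linarith
  · by_contra hfin
    have h1 := M.lam_le_of_fixed hfix (by linarith : 1 ≤ s) (hne s) (lt_top_iff_ne_top.2 hfin)
    rw [M.lam_eq_one_add (by linarith : s ≠ 0)] at h1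
    have h2 : M.mu 1 < M.mu s := by
      have hrt : r < t := by
        by_contra! h
        exact (hmu t ht h).ne hmt
      exact M.lt_mu_of_mu_eq (by linarith) hmr hrt hts hmt
    have : M.mu 1 * s < M.mu s * s := by
      have : 0 < s := by linarith
      gcongr
    linarith
  · exact M.I_eq_zero_of_fixed hfix ht.le (hne t) hlt hmt i hi

end MaxwellModel

/-! ### Assembly of the proposition. -/

theorem mainTheorem9 {N d : ℕ} (hd : 0 < d) (M : MaxwellModel N) (p : ℝ)
    (hp : 0 < p) (hp1 : p ≤ 1) (hpc : ENNReal.ofReal p < M.critExp) :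
    (∃ (ψ : ℝ≥0 → ℝ) (R : Measure ℝ≥0) (F : Measure (EuclideanSpace ℝ (Fin d)))
        (Φ : Measure ℝ≥0),
      M.IsProfile p ψ ∧ IsMixingMeasure p ψ R ∧
        IsFourierDistribution ψ F ∧ IsLaplaceDistribution ψ Φ) ∧
    ∀ (ψ : ℝ≥0 → ℝ) (R : Measure ℝ≥0) (F : Measure (EuclideanSpace ℝ (Fin d)))
        (Φ : Measure ℝ≥0),
      M.IsProfile p ψ → IsMixingMeasure p ψ R →
        IsFourierDistribution ψ F → IsLaplaceDistribution ψ Φ →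
      (p < 1 → ∀ s : ℝ, 0 < s →
        (fourierMoment F s < ∞ ↔ s < p) ∧ (laplaceMoment Φ s < ∞ ↔ s < p)) ∧
      (p = 1 →
        M.MomentAlternative R (fourierMoment F) ∧
        M.MomentAlternative R (laplaceMoment Φ)) := by
  constructor
  · obtain ⟨ψ, R, Φ, hψ, hR, hΦ⟩ := M.exists_profile_laplace hp hp1 hpc
    exact ⟨ψ, R, gaussMix d Φ, Φ, hψ, hR, isFourierDistribution_gaussMix d hΦ, hΦ⟩
  intro ψ R F Φ hψ hR hF hΦ
  have hΦp := hΦ.1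
  refine ⟨fun hlt s hs => ?_, ?_⟩
  · have h1 : laplaceMoment Φ s < ∞ ↔ s < p := by
      obtain ⟨ε, hε, C, hC⟩ := hψ.asymptotics
      refine laplaceMoment_lt_top_iff_of_asymptotics hlt hε (C := C) (fun x hx => ?_) hs
      lift x to ℝ≥0 using hx
      rw [hΦ.laplace_eq]
      exact hC x
    exact ⟨(hF.fourierMoment_lt_top_iff hd hΦ hs).trans h1, h1⟩
  · rintro rfl
    have hRp := hR.1
    -- For p = 1 the mixing representation is itself a Laplace transform in x.
    have hRΦ : R = Φ := ext_of_laplace fun y hy => by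
      lift y to ℝ≥0 using hy
      have h1 : laplace R ((y : ℝ) ^ (1 : ℝ)) = ψ y := hR.2 y
      rw [Real.rpow_one] at h1
      rw [h1, hΦ.laplace_eq]
    have h := M.momentAlternative_laplaceMoment hpc hψ hR
    have hL : M.MomentAlternative R (laplaceMoment Φ) := by rwa [hRΦ] at h ⊢
    exact ⟨hL.congr fun s hs => hF.fourierMoment_lt_top_iff hd hΦ hs, hL⟩
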